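/- **Setting.** Let $G=(V,E)$ be a finite simple directed graph with $n=|V|$ nodes, a source $s$ and a sink $t\neq s$. Every node and every edge has a positive integer capacity and every edge $e$ has a nonnegative integer transit time $d(e)$; let $\tau=\max_{e\in E}d(e)$ and assume $\tau\ge 1$. Initially $p\ge 1$ evacuees are at $s$. A *path* is a simple directed path from $s$ to $t$, and its transit time $T(P)$ is the sum of the transit times of its edges. Fix an arbitrary ranking (strict total order) of the paths. **CCRP.** A *route* is a path together with integer arrival and departure times at its nodes; a group using it enters each edge at the departure time from the tail, reaches the head $d(e)$ time units later, and may wait at intermediate nodes (it starts from $s$ at any time $\ge 0$ and leaves the network on reaching $t$). A group of size $g$ on a route reserves $g$ units of the capacity of each edge of the route at the time of entering it, and $g$ units of the capacity of each node at every time from arrival to departure. While there are evacuees left at $s$, CCRP chooses, among all routes on which all capacities needed are still positive after the previous reservations, one with the earliest arrival time at $t$; ties are broken in favour of smaller $T(P)$, then by the ranking of the paths, then in favour of smaller delay on the way. It reserves this route for a group whose size is the minimum of the number of evacuees left and of the available capacities along the route. The evacuation time $T^{CCRP}_{Evac}$ is the latest arrival time of a group at $t$, and $k$ is the number of distinct paths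 used. **SSEP.** For paths $P_1,\dots,P_i$ with transit times $T_j$ and capacities $C_j$ put $$CET=\left\lceil\frac{p+\sum_{j\le i}C_jT_j}{\sum_{j\le i}C_j}\right\rceil-1 .$$ SSEP starts with no path and $CET=\infty$. While fewer than $p$ paths have been selected and $t$ is reachable from $s$, it takes the path $P$ of smallest transit time in the current residual graph (ties broken by the same ranking), with $C$ the minimum residual capacity of its nodes and edges. If $T(P)\le CET$ for the paths selected so far, $P$ is selected with capacity $C$, the capacities of all its nodes and edges are permanently reduced by $C$, the nodes and edges with no capacity left are deleted, and $CET$ is recomputed; otherwise SSEP stops. The evacuation time $T^{SSEP}_{Evac}$ of its solution is the final value of $CET$; let $k'$ be the number of paths selected. **Theorem.** For any output of CCRP and any output of SSEP on such a network, $$T^{CCRP}_{Evac}\le\left\lfloor\frac pk\right\rfloor+(n-1)\tau-1,\qquad T^{SSEP}_{Evac}\le\left\lfloor\frac pk\right\rfloor+(n-1)\tau-1,\qquad T^{SSEP}_{Evac}\le\left\lfloor\frac p{k'}\right\rfloor+(n-1)\tau-1 .$$ -/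

import Mathlib

/-- A single-source single-sink evacuation network: a finite simple directed graph with
integral positive node and edge capacities and integral transit times. The values of
`edgeCap` and `transit` outside `edgeSet` are irrelevant. -/
structure EvacNetwork (V : Type*) where
  edgeSet : Finset (V × V)
  source : V
  sink : V
  source_ne_sink : source ≠ sink
  nodeCap : V → ℕ
  edgeCap : V × V → ℕ
  transit : V × V → ℕ
  nodeCap_pos : ∀ v, 0 < nodeCap v
  edgeCap_pos : ∀ e ∈ edgeSet, 0 < edgeCap e

/-- The consecutive pairs of a list of nodes, i.e. the edges traversed by the path. -/
def pathEdges {V : Type*} (P : List V) : List (V × V) := P.zip P.tail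

namespace EvacNetwork

variable {V : Type*}

/-- `P` is a simple directed path from the source to the sink. -/
def IsPath (N : EvacNetwork V) (P : List V) : Prop :=
  P.head? = some N.source ∧ P.getLast? = some N.sink ∧ P.Nodup ∧
    ∀ e ∈ pathEdges P, e ∈ N.edgeSet

/-- Transit time of a path. -/
def pathTransit (N : EvacNetwork V) (P : List V) : ℕ := ((pathEdges P).map N.transit).sum

/-- The maximum transit time of an edge. -/
def maxTransit (N : EvacNetwork V) : ℕ := N.edgeSet.sup N.transit

end EvacNetwork

/-- A route: a path together with the times `arr v` and `dep v` at which the people taking it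
arrive at and leave the node `v` (values at nodes off the path are irrelevant). -/
structure EvacRoute (V : Type*) where
  path : List V
  arr : V → ℕ
  dep : V → ℕ

/-- The route keeps node `v` occupied at time `x`. -/
def EvacRoute.UsesNode {V : Type*} (r : EvacRoute V) (v : V) (x : ℕ) : Prop :=
  v ∈ r.path ∧ r.arr v ≤ x ∧ x ≤ r.dep v

/-- The people on the route enter the edge `e` at time `x`. -/
def EvacRoute.UsesEdge {V : Type*} (r : EvacRoute V) (e : V × V) (x : ℕ) : Prop :=
  e ∈ pathEdges r.path ∧ x = r.dep e.1

namespace EvacNetwork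

variable {V : Type*}

/-- `r` is a route of the network. People may wait at intermediate nodes. A group appears on the
network when it starts from the source (before that it belongs to the initial
occupancy of the source) and leaves it on reaching the sink. -/
def IsRoute (N : EvacNetwork V) (r : EvacRoute V) : Prop :=
  N.IsPath r.path ∧ (∀ v ∈ r.path, r.arr v ≤ r.dep v) ∧
    (∀ e ∈ pathEdges r.path, r.arr e.2 = r.dep e.1 + N.transit e) ∧
    r.arr N.source = r.dep N.source ∧ r.arr N.sink = r.dep N.sink

open Classical in
/-- Capacity of node `v` still available at time `x`, given the groups (route and size)
reserved so far. -/
noncomputable def availNode (N : EvacNetwork V) (R : List (EvacRoute V × ℕ)) (v : V) (x : ℕ) : ℕ :=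
  N.nodeCap v - (R.map fun g => if g.1.UsesNode v x then g.2 else 0).sum

open Classical in
/-- Capacity of edge `e` still available for people entering it at time `x`. -/
noncomputable def availEdge (N : EvacNetwork V) (R : List (EvacRoute V × ℕ)) (e : V × V) (x : ℕ) :
    ℕ :=
  N.edgeCap e - (R.map fun g => if g.1.UsesEdge e x then g.2 else 0).sum

/-- The capacities available along the route `r`, subject to the prior reservations `R`. -/
def availAlong (N : EvacNetwork V) (R : List (EvacRoute V × ℕ)) (r : EvacRoute V) : Set ℕ :=
  {c | (∃ v x, r.UsesNode v x ∧ c = N.availNode R v x) ∨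
    (∃ e x, r.UsesEdge e x ∧ c = N.availEdge R e x)}

/-- `r` can be used by at least one more person, subject to the prior reservations `R`. -/
def IsFeasible (N : EvacNetwork V) (R : List (EvacRoute V × ℕ)) (r : EvacRoute V) : Prop :=
  N.IsRoute r ∧ ∀ c ∈ N.availAlong R r, 0 < c

/-- Total delay on the way: arrival time minus starting time minus transit time. -/
def delay (N : EvacNetwork V) (r : EvacRoute V) : ℕ :=
  r.arr N.sink - r.dep N.source - N.pathTransit r.path

/-- What the planner minimizes, lexicographically: the destination arrival time; ties
are broken by the transit time of the path, then by a fixed ranking of the paths, then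
by the delay on the way. -/
def routeKey (N : EvacNetwork V) (rank : List V → ℕ) (r : EvacRoute V) : ℕ ×ₗ ℕ ×ₗ ℕ ×ₗ ℕ :=
  toLex (r.arr N.sink, toLex (N.pathTransit r.path, toLex (rank r.path, N.delay r)))

/-- Total number of people in the groups `R`. -/
def evacuated (R : List (EvacRoute V × ℕ)) : ℕ := (R.map Prod.snd).sum

/-- `R` is the list of groups reserved by CCRP with `p` evacuees after finitely many iterations. -/
inductive CCRPReach (N : EvacNetwork V) (p : ℕ) (rank : List V → ℕ) :
    List (EvacRoute V × ℕ) → Prop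
  | init : CCRPReach N p rank []
  | step (R : List (EvacRoute V × ℕ)) (r : EvacRoute V) (g : ℕ)
      (hR : CCRPReach N p rank R)
      (hleft : evacuated R < p)
      (hfeas : N.IsFeasible R r)
      (hmin : ∀ r', N.IsFeasible R r' → N.routeKey rank r ≤ N.routeKey rank r')
      (hgroup : IsLeast (insert (p - evacuated R) (N.availAlong R r)) g) :
      CCRPReach N p rank (R ++ [(r, g)])

/-- `R` is the evacuation plan returned by CCRP: no evacuee is left at the source. -/
def IsCCRPOutput (N : EvacNetwork V) (p : ℕ) (rank : List V → ℕ)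
    (R : List (EvacRoute V × ℕ)) : Prop :=
  CCRPReach N p rank R ∧ evacuated R = p

/-- Evacuation time of a plan: the time at which the last group reaches the sink. -/
def evacTime (N : EvacNetwork V) (R : List (EvacRoute V × ℕ)) : ℕ :=
  (R.map fun g => g.1.arr N.sink).foldr max 0

/-- Number of distinct paths used by a plan. -/
def numPaths [DecidableEq V] (R : List (EvacRoute V × ℕ)) : ℕ :=
  (R.map fun g => g.1.path).toFinset.card

/-- Combined evacuation time for `p` people on a list of paths with capacities. -/
def CET (N : EvacNetwork V) (p : ℕ) (S : List (List V × ℕ)) : ℤ :=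
  ⌈((p + (S.map fun a => a.2 * N.pathTransit a.1).sum : ℕ) : ℚ) / ((S.map Prod.snd).sum : ℕ)⌉ - 1

open Classical in
/-- Node capacity left once the capacities of all paths in `S` are permanently deducted. -/
noncomputable def residualNode (N : EvacNetwork V) (S : List (List V × ℕ)) (v : V) : ℕ :=
  N.nodeCap v - (S.map fun a => if v ∈ a.1 then a.2 else 0).sum

open Classical in
/-- Edge capacity left once the capacities of all paths in `S` are permanently deducted. -/
noncomputable def residualEdge (N : EvacNetwork V) (S : List (List V × ℕ)) (e : V × V) : ℕ :=
  N.edgeCap e - (S.map fun a => if e ∈ pathEdges a.1 then a.2 else 0).sum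

/-- The residual capacities of the nodes and edges of `P`. -/
def residualAlong (N : EvacNetwork V) (S : List (List V × ℕ)) (P : List V) : Set ℕ :=
  {c | (∃ v ∈ P, c = N.residualNode S v) ∨ (∃ e ∈ pathEdges P, c = N.residualEdge S e)}

/-- `P` is a path of the residual graph, in which the saturated nodes and edges
(those with no capacity left) have been deleted. -/
def IsResidualPath (N : EvacNetwork V) (S : List (List V × ℕ)) (P : List V) : Prop :=
  N.IsPath P ∧ ∀ c ∈ N.residualAlong S P, 0 < c

/-- Transit time of a path, ties being broken by the ranking. -/
def pathKey (N : EvacNetwork V) (rank : List V → ℕ) (P : List V) : ℕ ×ₗ ℕ :=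
  toLex (N.pathTransit P, rank P)

/-- SSEP, having selected the paths with capacities `S`, adds `P` with capacity `C`. -/
structure SSEPStep (N : EvacNetwork V) (p : ℕ) (rank : List V → ℕ) (S : List (List V × ℕ))
    (P : List V) (C : ℕ) : Prop where
  length_lt : S.length < p
  residual : N.IsResidualPath S P
  shortest : ∀ P', N.IsResidualPath S P' → N.pathKey rank P ≤ N.pathKey rank P'
  capacity : IsLeast (N.residualAlong S P) C
  transit_le : S ≠ [] → (N.pathTransit P : ℤ) ≤ N.CET p S

/-- `S` is the list of paths with capacities selected by SSEP after finitely many iterations. -/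
inductive SSEPReach (N : EvacNetwork V) (p : ℕ) (rank : List V → ℕ) : List (List V × ℕ) → Prop
  | init : SSEPReach N p rank []
  | step (S : List (List V × ℕ)) (P : List V) (C : ℕ)
      (hS : SSEPReach N p rank S) (hstep : SSEPStep N p rank S P C) :
      SSEPReach N p rank (S ++ [(P, C)])

/-- `S` is the list of paths with capacities returned by SSEP: no further path is added. The
evacuation time of its solution is the combined evacuation time `N.CET p S`. -/
def IsSSEPOutput (N : EvacNetwork V) (p : ℕ) (rank : List V → ℕ) (S : List (List V × ℕ)) : Prop :=
  SSEPReach N p rank S ∧ ∀ P C, ¬ SSEPStep N p rank S P C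

/-- The bound `⌊p / k⌋ + (n - 1) τ - 1`. -/
def evacBound [Fintype V] (N : EvacNetwork V) (p k : ℕ) : ℤ :=
  ⌊(p : ℚ) / k⌋ + ((Fintype.card V : ℤ) - 1) * N.maxTransit - 1

end EvacNetwork

/-! Both procedures follow one static greedy decomposition. Process all paths in the order of
transit time and rank and give each the bottleneck capacity that its predecessors leave
(`greedyCap`); call a path selected if this is positive. SSEP selects an initial segment of the
selected paths.

The engine is an exchange of tails (`OpenPath.suffix_le`). Let `Q` be selected and let `P` be open
at the turn of `Q`. If they share a node `v`, both hybrids consist of elements open at that turn,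
where `Q` is shortest. Hence `Q` reaches `v`, and the sink from `v`, at least as fast as `P`.

So in time the greedy paths do not interfere. CCRP fills the slots (arrival time, selected path) in
lexicographic order, without waiting and with the full greedy capacity, except perhaps for the last
group (`Fills.choice`, `CCRPReach.fills`). A feasible route before the next slot is impossible: some
element of its path is saturated by greedy paths whose slots at that moment are already filled.

The bounds come from counting. If every path of a set of `k` selected paths delivers at least one
person per time unit from its transit time on, and fewer than `p` arrive before `m`, then `k * m < p
+ ∑ T`. At most one selected path attains the transit time `(n - 1) τ` (`pathTransit_lt_of_before`),
which yields the final `- 1`. For CCRP, `m` is the last arrival time; for SSEP it is the combined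
evacuation time. Comparing SSEP with the CCRP slots (`IsSSEPOutput.CET_le`) carries the CCRP bound
over to SSEP. -/

namespace EvacNetwork

variable {V : Type*}

/-! ### Lists as walks, and extraction of simple paths. -/

section Lists

lemma pathEdges_cons_cons (u v : V) (l : List V) :
    pathEdges (u :: v :: l) = (u, v) :: pathEdges (v :: l) := rfl

lemma pathEdges_append_cons (A : List V) (v : V) (B : List V) :
    pathEdges (A ++ v :: B) = pathEdges (A ++ [v]) ++ pathEdges (v :: B) := by
  induction A with
  | nil => rfl
  | cons u A ih =>
    cases A with
    | nil => rfl
    | cons w A =>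
      simp only [List.cons_append, pathEdges_cons_cons] at ih ⊢
      rw [ih]

lemma pathTransit_append_cons (N : EvacNetwork V) (A : List V) (v : V) (B : List V) :
    N.pathTransit (A ++ v :: B) = N.pathTransit (A ++ [v]) + N.pathTransit (v :: B) := by
  simp [pathTransit, pathEdges_append_cons A v B]

lemma pathTransit_cons_cons (N : EvacNetwork V) (u v : V) (l : List V) :
    N.pathTransit (u :: v :: l) = N.transit (u, v) + N.pathTransit (v :: l) := rfl

lemma fst_mem_of_mem_pathEdges {e : V × V} {P : List V} (h : e ∈ pathEdges P) : e.1 ∈ P :=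
  (List.of_mem_zip (a := e.1) (b := e.2) h).1

/-- Splitting a path at the tail of one of its edges. -/
lemma exists_split_of_mem_pathEdges {e : V × V} {P : List V} (h : e ∈ pathEdges P) :
    ∃ A B, P = A ++ e.1 :: e.2 :: B := by
  induction P with
  | nil => simp [pathEdges] at h
  | cons u P ih =>
    cases P with
    | nil => simp [pathEdges] at h
    | cons v P =>
      rw [pathEdges_cons_cons, List.mem_cons] at h
      rcases h with rfl | h
      · exact ⟨[], P, rfl⟩
      · obtain ⟨A, B, hAB⟩ := ih h
        exact ⟨u :: A, B, by rw [hAB]; rfl⟩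

/-- Every walk contains a simple path with the same ends that is not longer. -/
lemma exists_simple_subwalk (N : EvacNetwork V) (W : List V) :
    ∃ P : List V, P.head? = W.head? ∧ P.getLast? = W.getLast? ∧ P.Nodup ∧ P ⊆ W ∧
      pathEdges P ⊆ pathEdges W ∧ N.pathTransit P ≤ N.pathTransit W := by
  classical
  induction W with
  | nil => exact ⟨[], by simp⟩
  | cons u W ih =>
    cases W with
    | nil => exact ⟨[u], by simp⟩
    | cons w W =>
      obtain ⟨P, h1, h2, h3, h4, h5, h6⟩ := ih
      -- If `u` recurs, the detour from `u` back to `u` is cut out.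
      by_cases hu : u ∈ P
      · obtain ⟨A, B, rfl⟩ := List.append_of_mem hu
        refine ⟨u :: B, by simp, ?_, (List.nodup_append.1 h3).2.1, ?_, ?_, ?_⟩
        · rw [List.getLast?_cons_cons, ← h2, List.getLast?_append_cons]
        · intro z hz
          exact List.mem_cons_of_mem _ (h4 (List.mem_append_right _ hz))
        · intro z hz
          rw [pathEdges_cons_cons]
          refine List.mem_cons_of_mem _ (h5 ?_)
          rw [pathEdges_append_cons]
          exact List.mem_append_right _ hz
        · rw [pathTransit_cons_cons]
          rw [pathTransit_append_cons] at h6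
          omega
      · cases P with
        | nil => simp at h1
        | cons x P =>
          obtain rfl : x = w := by simpa using h1
          refine ⟨u :: x :: P, by simp, ?_, List.nodup_cons.2 ⟨hu, h3⟩, ?_, ?_, ?_⟩
          · rw [List.getLast?_cons_cons, h2, List.getLast?_cons_cons]
          · exact List.cons_subset_cons _ h4
          · rw [pathEdges_cons_cons, pathEdges_cons_cons]
            exact List.cons_subset_cons _ h5
          · rw [pathTransit_cons_cons, pathTransit_cons_cons]
            omega

end Lists

/-! ### Transit time from a node of a path to the sink. -/

section Suffix

variable [DecidableEq V]

/-- Transit time of the part of `P` that starts at `v`. -/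
def suffixTransit (N : EvacNetwork V) (P : List V) (v : V) : ℕ :=
  N.pathTransit (P.drop (P.idxOf v))

lemma suffixTransit_append_cons (N : EvacNetwork V) {A : List V} {v : V} {B : List V}
    (h : v ∉ A) : N.suffixTransit (A ++ v :: B) v = N.pathTransit (v :: B) := by
  simp [suffixTransit, List.idxOf_append_of_notMem h]

lemma exists_split (N : EvacNetwork V) {P : List V} (hP : P.Nodup) {v : V} (hv : v ∈ P) :
    ∃ A B, P = A ++ v :: B ∧ A.length = P.idxOf v ∧
      N.suffixTransit P v = N.pathTransit (v :: B) ∧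
      N.pathTransit P = N.pathTransit (A ++ [v]) + N.suffixTransit P v := by
  obtain ⟨A, B, rfl⟩ := List.append_of_mem hv
  have hA : v ∉ A := fun h => (List.nodup_append.1 hP).2.2 v h v (by simp) rfl
  refine ⟨A, B, rfl, ?_, N.suffixTransit_append_cons hA, ?_⟩
  · simp [List.idxOf_append_of_notMem hA]
  · rw [N.suffixTransit_append_cons hA, pathTransit_append_cons]

lemma suffixTransit_le (N : EvacNetwork V) {P : List V} (hP : P.Nodup) {v : V} (hv : v ∈ P) :
    N.suffixTransit P v ≤ N.pathTransit P := by
  obtain ⟨A, B, -, -, -, h⟩ := N.exists_split hP hv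
  omega

lemma suffixTransit_edge (N : EvacNetwork V) {P : List V} (hP : P.Nodup) {e : V × V}
    (he : e ∈ pathEdges P) :
    N.suffixTransit P e.1 = N.transit e + N.suffixTransit P e.2 := by
  obtain ⟨A, B, rfl⟩ := exists_split_of_mem_pathEdges he
  have h1 : e.1 ∉ A := fun h => (List.nodup_append.1 hP).2.2 _ h _ (by simp) rfl
  have h2 : e.2 ∉ A ++ [e.1] := by
    have : (A ++ [e.1] ++ e.2 :: B).Nodup := by simpa using hP
    exact fun h => (List.nodup_append.1 this).2.2 _ h _ (by simp) rfl
  rw [N.suffixTransit_append_cons h1, pathTransit_cons_cons]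
  have := N.suffixTransit_append_cons (B := B) h2
  rw [List.append_assoc, List.singleton_append] at this
  rw [this]

lemma suffixTransit_source (N : EvacNetwork V) {P : List V} (hP : N.IsPath P) :
    N.suffixTransit P N.source = N.pathTransit P := by
  obtain ⟨h, -⟩ := hP
  cases P with
  | nil => simp at h
  | cons u P =>
    obtain rfl : u = N.source := by simpa using h
    simp [suffixTransit]

omit [DecidableEq V] in
lemma IsPath.source_mem {N : EvacNetwork V} {P : List V} (hP : N.IsPath P) : N.source ∈ P :=
  List.mem_of_head? hP.1

lemma suffixTransit_sink (N : EvacNetwork V) {P : List V} (hP : N.IsPath P) :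
    N.suffixTransit P N.sink = 0 := by
  obtain ⟨l, rfl⟩ := List.getLast?_eq_some_iff.1 hP.2.1
  have hA : N.sink ∉ l := fun h => (List.nodup_append.1 hP.2.2.1).2.2 _ h _ (by simp) rfl
  rw [N.suffixTransit_append_cons hA]
  rfl

omit [DecidableEq V] in
/-- Transit times of walks in terms of their lengths. -/
lemma pathTransit_le_length (N : EvacNetwork V) {P : List V} (h : ∀ e ∈ pathEdges P, e ∈ N.edgeSet) :
    N.pathTransit P ≤ (P.length - 1) * N.maxTransit := by
  have h1 : (pathEdges P).length = P.length - 1 := by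
    simp [pathEdges]
  have := List.sum_le_card_nsmul ((pathEdges P).map N.transit) N.maxTransit (by
    intro x hx
    obtain ⟨e, he, rfl⟩ := List.mem_map.1 hx
    exact Finset.le_sup (f := N.transit) (h e he))
  simpa [pathTransit, h1] using this

/-- Bounds on the transit times of the two parts of a path. -/
lemma IsPath.split_bounds {N : EvacNetwork V} {P : List V} (hP : N.IsPath P) {v : V}
    (hv : v ∈ P) :
    N.suffixTransit P v ≤ (P.length - 1 - P.idxOf v) * N.maxTransit ∧
      N.pathTransit P ≤ P.idxOf v * N.maxTransit + N.suffixTransit P v := by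
  obtain ⟨A, B, hAB, hlen, hs, ht⟩ := N.exists_split hP.2.2.1 hv
  have hE := hP.2.2.2
  rw [hAB, pathEdges_append_cons] at hE
  have h1 := N.pathTransit_le_length (P := A ++ [v]) fun e he => hE e (List.mem_append_left _ he)
  have h2 := N.pathTransit_le_length (P := v :: B) fun e he => hE e (List.mem_append_right _ he)
  have hl : P.length = A.length + (B.length + 1) := by rw [hAB]; simp
  rw [hlen.symm, hs]
  refine ⟨?_, ?_⟩
  · refine h2.trans (Nat.mul_le_mul_right _ ?_)
    simp only [List.length_cons]
    omega
  · simp only [List.length_append, List.length_singleton, Nat.add_sub_cancel] at h1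
    omega

omit [DecidableEq V] in
lemma IsPath.transit_le [Fintype V] {N : EvacNetwork V} {P : List V} (hP : N.IsPath P) :
    N.pathTransit P ≤ (Fintype.card V - 1) * N.maxTransit :=
  (N.pathTransit_le_length hP.2.2.2).trans
    (Nat.mul_le_mul_right _ (Nat.sub_le_sub_right hP.2.2.1.length_le_card 1))

end Suffix

/-! ### Uniform treatment of nodes and edges. -/

section Element

/-- The nodes and the edges of the network, treated alike. -/
abbrev Element (V : Type*) := V ⊕ (V × V)

/-- Capacity of a node or an edge. -/
def cap (N : EvacNetwork V) : Element V → ℕ := Sum.elim N.nodeCap N.edgeCap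

/-- The node or edge lies on the path. -/
def On (x : Element V) (P : List V) : Prop :=
  Sum.elim (fun v => v ∈ P) (fun e => e ∈ pathEdges P) x

/-- The node at which an element is entered. -/
def base : Element V → V := Sum.elim id Prod.fst

/-- The route needs the capacity of the element `x` at time `z`. -/
def Uses (r : EvacRoute V) (x : Element V) (z : ℕ) : Prop :=
  Sum.elim (fun v => r.UsesNode v z) (fun e => r.UsesEdge e z) x

lemma base_mem {x : Element V} {P : List V} (h : On x P) : base x ∈ P := by
  cases x with
  | inl v => exact h
  | inr e => exact fst_mem_of_mem_pathEdges h

lemma cap_pos {N : EvacNetwork V} {P : List V} (hP : N.IsPath P) {x : Element V} (h : On x P) :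
    0 < N.cap x := by
  cases x with
  | inl v => exact N.nodeCap_pos v
  | inr e => exact N.edgeCap_pos e (hP.2.2.2 e h)

/-- Each element of the hybrid lies before or after the junction `v`, hence on one of the two
original paths. This keeps exchanged tails inside a residual graph. -/
lemma On.splice {A B A' B' : List V} {v : V} {x : Element V} (h : On x (A' ++ v :: B)) :
    On x (A' ++ v :: B') ∨ On x (A ++ v :: B) := by
  cases x with
  | inl u =>
    simp only [On, Sum.elim_inl, List.mem_append, List.mem_cons] at h ⊢
    tauto
  | inr e =>
    simp only [On, Sum.elim_inr] at h ⊢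
    rw [pathEdges_append_cons, List.mem_append] at h ⊢
    rw [pathEdges_append_cons A, List.mem_append]
    tauto

end Element

/-! ### The static greedy decomposition and the exchange argument. -/

section Greedy

lemma finite_isPath [Finite V] (N : EvacNetwork V) : {P | N.IsPath P}.Finite := by
  have := Fintype.ofFinite V
  exact (List.finite_length_le V (Fintype.card V)).subset fun P hP => hP.2.2.1.length_le_card

/-- The finite set of all paths. -/
noncomputable def paths [Finite V] (N : EvacNetwork V) : Finset (List V) :=
  N.finite_isPath.toFinset

@[simp] lemma mem_paths [Finite V] {N : EvacNetwork V} {P : List V} :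
    P ∈ N.paths ↔ N.IsPath P := by
  simp [paths]

lemma pathKey_injective (N : EvacNetwork V) {rank : List V → ℕ}
    (hrank : Function.Injective rank) : Function.Injective (N.pathKey rank) := by
  intro P Q h
  have h' := toLex.injective h
  exact hrank (Prod.ext_iff.1 h').2

lemma pathTransit_mono {N : EvacNetwork V} {rank : List V → ℕ} {P Q : List V}
    (h : N.pathKey rank P ≤ N.pathKey rank Q) : N.pathTransit P ≤ N.pathTransit Q := by
  rcases Prod.Lex.toLex_le_toLex.1 h with h | h
  · exact h.le
  · exact h.1.le

lemma wellFounded_pathKey (N : EvacNetwork V) (rank : List V → ℕ) :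
    WellFounded fun Q P => N.pathKey rank Q < N.pathKey rank P :=
  InvImage.wf (N.pathKey rank) wellFounded_lt

variable [Finite V]

open Classical in
/-- The capacity that the greedy procedure, which processes all paths in the order of their keys,
assigns to a path; it is zero for the paths that are not selected. -/
noncomputable def greedyCap (N : EvacNetwork V) (rank : List V → ℕ) : List V → ℕ :=
  (N.wellFounded_pathKey rank).fix fun P c =>
    sInf {n | ∃ x, On x P ∧ n = N.cap x - ∑ Q ∈ N.paths,
      if h : N.pathKey rank Q < N.pathKey rank P then (if On x Q then c Q h else 0) else 0}

open Classical in
/-- The capacity of `x` taken by the paths in `D`. -/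
noncomputable def used (N : EvacNetwork V) (rank : List V → ℕ) (D : List V → Prop)
    (x : Element V) : ℕ :=
  ∑ Q ∈ N.paths with D Q ∧ On x Q, N.greedyCap rank Q

variable {N : EvacNetwork V} {rank : List V → ℕ}

/-- The paths before `P`. -/
abbrev Before (N : EvacNetwork V) (rank : List V → ℕ) (P Q : List V) : Prop :=
  N.pathKey rank Q < N.pathKey rank P

/-- The paths up to `P`. -/
abbrev Upto (N : EvacNetwork V) (rank : List V → ℕ) (P Q : List V) : Prop :=
  N.pathKey rank Q ≤ N.pathKey rank P

lemma greedyCap_eq (N : EvacNetwork V) (rank : List V → ℕ) (P : List V) :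
    N.greedyCap rank P =
      sInf {n | ∃ x, On x P ∧ n = N.cap x - N.used rank (N.Before rank P) x} := by
  classical
  have h : ∀ x, N.used rank (N.Before rank P) x = ∑ Q ∈ N.paths,
      if N.pathKey rank Q < N.pathKey rank P then
        (if On x Q then N.greedyCap rank Q else 0) else 0 := by
    intro x
    rw [used, Finset.sum_filter]
    refine Finset.sum_congr rfl fun Q _ => ?_
    by_cases h1 : N.pathKey rank Q < N.pathKey rank P <;> by_cases h2 : On x Q <;>
      simp [Before, h1, h2]
  simp only [h]
  conv_lhs => rw [greedyCap, WellFounded.fix_eq]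
  simp only [dite_eq_ite]
  congr! 6

lemma greedyCap_le {P : List V} {x : Element V} (hx : On x P) :
    N.greedyCap rank P ≤ N.cap x - N.used rank (N.Before rank P) x := by
  rw [greedyCap_eq]
  exact Nat.sInf_le ⟨x, hx, rfl⟩

lemma exists_greedyCap_eq {P : List V} (hP : N.IsPath P) :
    ∃ x, On x P ∧ N.greedyCap rank P = N.cap x - N.used rank (N.Before rank P) x := by
  rw [greedyCap_eq]
  exact Nat.sInf_mem (s := {n | ∃ x, On x P ∧ n = N.cap x - N.used rank (N.Before rank P) x})
    ⟨_, Sum.inl N.source, hP.source_mem, rfl⟩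

/-- Paths of greedy capacity zero contribute nothing, so only selected paths through `x` need
comparing. -/
lemma used_mono_of_pos {D D' : List V → Prop} {x : Element V}
    (h : ∀ Q, N.IsPath Q → On x Q → 0 < N.greedyCap rank Q → D Q → D' Q) :
    N.used rank D x ≤ N.used rank D' x := by
  classical
  refine Finset.sum_le_sum_of_ne_zero fun Q hQ h0 => ?_
  simp only [Finset.mem_filter, mem_paths] at hQ ⊢
  exact ⟨hQ.1, h Q hQ.1 hQ.2.2 (Nat.pos_of_ne_zero h0) hQ.2.1, hQ.2.2⟩

lemma used_congr {D D' : List V → Prop} {x : Element V}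
    (h : ∀ Q, N.IsPath Q → On x Q → 0 < N.greedyCap rank Q → (D Q ↔ D' Q)) :
    N.used rank D x = N.used rank D' x :=
  le_antisymm (used_mono_of_pos fun Q h1 h2 h3 => (h Q h1 h2 h3).1)
    (used_mono_of_pos fun Q h1 h2 h3 => (h Q h1 h2 h3).2)

lemma used_upto (hrank : Function.Injective rank) {P : List V} (hP : N.IsPath P) {x : Element V}
    (hx : On x P) :
    N.used rank (N.Upto rank P) x =
      N.used rank (N.Before rank P) x + N.greedyCap rank P := by
  classical
  rw [used, used, add_comm, ← Finset.sum_insert (by simp [Before])]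
  congr 1
  ext Q
  simp only [Finset.mem_filter, Finset.mem_insert, mem_paths, Upto, Before, le_iff_lt_or_eq,
    (N.pathKey_injective hrank).eq_iff]
  constructor
  · rintro ⟨h1, h2 | h2, h3⟩
    · exact Or.inr ⟨h1, h2, h3⟩
    · exact Or.inl h2
  · rintro (rfl | ⟨h1, h2, h3⟩)
    · exact ⟨hP, Or.inr rfl, hx⟩
    · exact ⟨h1, Or.inl h2, h3⟩

/-- The last selected path through `x` took no more than its predecessors had left there. -/
lemma used_le_cap (hrank : Function.Injective rank) (D : List V → Prop) (x : Element V) :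
    N.used rank D x ≤ N.cap x := by
  classical
  by_cases h : ∃ Q ∈ N.paths.filter fun Q => On x Q, 0 < N.greedyCap rank Q
  · obtain ⟨P, hP, hmax⟩ := Finset.exists_max_image
      ((N.paths.filter fun Q => On x Q).filter fun Q => 0 < N.greedyCap rank Q) (N.pathKey rank)
      (by obtain ⟨Q, h1, h2⟩ := h; exact ⟨Q, Finset.mem_filter.2 ⟨h1, h2⟩⟩)
    simp only [Finset.mem_filter, mem_paths] at hP hmax
    have h1 : N.used rank D x ≤ N.used rank (N.Upto rank P) x :=
      used_mono_of_pos fun Q h1 h2 h3 _ => hmax Q ⟨⟨h1, h2⟩, h3⟩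
    rw [used_upto hrank hP.1.1 hP.1.2] at h1
    have := greedyCap_le (N := N) (rank := rank) hP.1.2
    omega
  · push Not at h
    refine (Finset.sum_eq_zero fun Q hQ => ?_).trans_le (Nat.zero_le _)
    simp only [Finset.mem_filter] at hQ
    exact Nat.le_zero.1 (h Q (by simp [mem_paths.1 hQ.1, hQ.2.2]))

/-- After the paths up to `P` some element of `P` is saturated. -/
lemma exists_saturated (hrank : Function.Injective rank) {P : List V} (hP : N.IsPath P) :
    ∃ x, On x P ∧ N.used rank (N.Upto rank P) x = N.cap x := by
  obtain ⟨x, hx, h⟩ := exists_greedyCap_eq (rank := rank) hP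
  refine ⟨x, hx, ?_⟩
  rw [used_upto hrank hP hx, h]
  have := used_le_cap (N := N) hrank (N.Before rank P) x
  omega

/-- `P` is a path on which capacity remains when that of the paths in `D` is taken. -/
def OpenPath (N : EvacNetwork V) (rank : List V → ℕ) (D : List V → Prop) (P : List V) : Prop :=
  N.IsPath P ∧ ∀ x, On x P → N.used rank D x < N.cap x

lemma greedyCap_pos_iff {P : List V} (hP : N.IsPath P) :
    0 < N.greedyCap rank P ↔ N.OpenPath rank (N.Before rank P) P := by
  constructor
  · intro h
    refine ⟨hP, fun x hx => ?_⟩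
    have := greedyCap_le (N := N) (rank := rank) hx
    omega
  · intro h
    obtain ⟨x, hx, h'⟩ := exists_greedyCap_eq (rank := rank) hP
    have := h.2 x hx
    omega

lemma OpenPath.anti {D D' : List V → Prop} {P : List V} (h : N.OpenPath rank D P)
    (hD : ∀ Q, N.IsPath Q → 0 < N.greedyCap rank Q → D' Q → D Q) : N.OpenPath rank D' P :=
  ⟨h.1, fun x hx => (used_mono_of_pos fun Q h1 _ h3 => hD Q h1 h3).trans_lt (h.2 x hx)⟩

/-- A path that is still open before `Q` is not earlier than `Q`. -/
lemma OpenPath.le (hrank : Function.Injective rank) {P Q : List V}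
    (h : N.OpenPath rank (N.Before rank Q) P) : N.pathKey rank Q ≤ N.pathKey rank P := by
  by_contra! hlt
  -- The turn of `P` saturates one of its elements, so `P` cannot still be open at a later turn.
  obtain ⟨x, hx, hs⟩ := exists_saturated hrank h.1
  have h1 := h.2 x hx
  have h2 : N.used rank (N.Upto rank P) x ≤ N.used rank (N.Before rank Q) x :=
    used_mono_of_pos fun R _ _ _ hR => lt_of_le_of_lt hR hlt
  omega

/-- A selected path reaches each of its nodes, and the sink from there, as fast as any path of the
residual graph in which it was selected. -/
lemma OpenPath.suffix_le [DecidableEq V] (hrank : Function.Injective rank) {P Q : List V}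
    (hQ : N.OpenPath rank (N.Before rank Q) Q) (hP : N.OpenPath rank (N.Before rank Q) P)
    {v : V} (hvQ : v ∈ Q) (hvP : v ∈ P) :
    N.suffixTransit Q v ≤ N.suffixTransit P v ∧
      N.pathTransit Q + N.suffixTransit P v ≤ N.pathTransit P + N.suffixTransit Q v := by
  -- A walk made of elements of `P` and `Q` contains a simple path that is open at the turn of `Q`,
  -- and no such path is shorter than `Q`.
  have key : ∀ W : List V, W.head? = some N.source → W.getLast? = some N.sink →
      (∀ x, On x W → On x P ∨ On x Q) → N.pathTransit Q ≤ N.pathTransit W := by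
    intro W h1 h2 h3
    obtain ⟨X, e1, e2, e3, e4, e5, e6⟩ := N.exists_simple_subwalk W
    have hXW : ∀ x, On x X → On x W := by
      rintro (u | e) hx
      · exact e4 hx
      · exact e5 hx
    have hX : N.OpenPath rank (N.Before rank Q) X := by
      refine ⟨⟨e1.trans h1, e2.trans h2, e3, fun e he => ?_⟩, fun x hx => ?_⟩
      · rcases h3 (Sum.inr e) (hXW (Sum.inr e) he) with h | h
        · exact hP.1.2.2.2 e h
        · exact hQ.1.2.2.2 e h
      · rcases h3 x (hXW x hx) with h | h
        · exact hP.2 x h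
        · exact hQ.2 x h
    exact (pathTransit_mono (hX.le hrank)).trans e6
  obtain ⟨A, B, hAB, -, hs, ht⟩ := N.exists_split hQ.1.2.2.1 hvQ
  obtain ⟨A', B', hAB', -, hs', ht'⟩ := N.exists_split hP.1.2.2.1 hvP
  -- The start of `Q` with the end of `P` compares the parts after `v`; the other hybrid, `c2`,
  -- compares the parts before `v`.
  have c1 := key (A ++ v :: B') (by
      have := hQ.1.1
      rw [hAB] at this
      cases A <;> simpa using this) (by
      have := hP.1.2.1
      rw [hAB', List.getLast?_append_cons] at this
      rw [List.getLast?_append_cons, this]) (fun x hx => by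
      rw [hAB, hAB']
      exact (hx.splice (A := A') (B' := B)).symm)
  have c2 := key (A' ++ v :: B) (by
      have := hP.1.1
      rw [hAB'] at this
      cases A' <;> simpa using this) (by
      have := hQ.1.2.1
      rw [hAB, List.getLast?_append_cons] at this
      rw [List.getLast?_append_cons, this]) (fun x hx => by
      rw [hAB, hAB']
      exact (hx.splice (A := A) (B' := B')))
  rw [pathTransit_append_cons] at c1 c2
  omega

/-- Of the selected paths only the last one may have the largest conceivable transit time. -/
lemma pathTransit_lt_of_before {V : Type*} [Fintype V] [DecidableEq V] {N : EvacNetwork V}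
    {rank : List V → ℕ} (hτ : 0 < N.maxTransit)
    (hrank : Function.Injective rank) {P Q : List V} (hQ : N.IsPath Q) (hP : N.IsPath P)
    (cQ : 0 < N.greedyCap rank Q) (cP : 0 < N.greedyCap rank P)
    (hlt : N.pathKey rank Q < N.pathKey rank P) :
    N.pathTransit Q < (Fintype.card V - 1) * N.maxTransit := by
  rw [greedyCap_pos_iff hQ] at cQ
  rw [greedyCap_pos_iff hP] at cP
  have cP' := cP.anti (D' := N.Before rank Q) fun R _ _ h => lt_trans h hlt
  by_contra! hge
  have hP1 : (Fintype.card V - 1) * N.maxTransit ≤ N.pathTransit P :=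
    hge.trans (pathTransit_mono hlt.le)
  have hn : 0 < Fintype.card V := Fintype.card_pos_iff.2 ⟨N.source⟩
  -- With edges of transit time at most `τ`, the total `(n - 1) τ` forces the path to visit all
  -- nodes.
  have full : ∀ X : List V, N.IsPath X → (Fintype.card V - 1) * N.maxTransit ≤ N.pathTransit X →
      X.length = Fintype.card V := by
    intro X hX h
    have h1 := h.trans (N.pathTransit_le_length hX.2.2.2)
    have h2 := Nat.le_of_mul_le_mul_right h1 hτ
    have h3 := hX.2.2.1.length_le_card
    have h4 : 0 < X.length := List.length_pos_of_mem hX.source_mem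
    omega
  have lQ := full Q hQ hge
  have lP := full P hP hP1
  -- Both bounds of `split_bounds` are then tight, so the time left to the sink determines the
  -- position of a node.
  have idx : ∀ X : List V, N.IsPath X → (Fintype.card V - 1) * N.maxTransit ≤ N.pathTransit X →
      ∀ v ∈ X, N.suffixTransit X v = (X.length - 1 - X.idxOf v) * N.maxTransit := by
    intro X hX h v hv
    obtain ⟨b1, b2⟩ := hX.split_bounds hv
    have h3 : X.idxOf v < X.length := List.idxOf_lt_length_of_mem hv
    have h4 : X.length - 1 = (X.length - 1 - X.idxOf v) + X.idxOf v := by omega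
    rw [← full X hX h, h4, add_mul] at h
    omega
  have hmem : ∀ X : List V, X.Nodup → X.length = Fintype.card V → ∀ v, v ∈ X := by
    intro X hX hl v
    have : X.toFinset = Finset.univ := by
      rw [← Finset.card_eq_iff_eq_univ, List.toFinset_card_of_nodup hX, hl]
    rw [← List.mem_toFinset, this]
    exact Finset.mem_univ v
  -- As the two paths have equal transit time, the two exchange inequalities give equal suffixes at
  -- every node.
  have same : ∀ v, P.idxOf v = Q.idxOf v := by
    intro v
    have mQ := hmem Q hQ.2.2.1 lQ v
    have mP := hmem P hP.2.2.1 lP v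
    obtain ⟨s1, s2⟩ := cQ.suffix_le hrank cP' mQ mP
    have tP := hP.transit_le
    have hs : N.suffixTransit Q v = N.suffixTransit P v := by omega
    rw [idx Q hQ hge v mQ, idx P hP hP1 v mP] at hs
    have := Nat.eq_of_mul_eq_mul_right hτ hs
    have i1 : Q.idxOf v < Q.length := List.idxOf_lt_length_of_mem mQ
    have i2 : P.idxOf v < P.length := List.idxOf_lt_length_of_mem mP
    omega
  have : P = Q := by
    refine List.ext_getElem (by omega) fun i h1 h2 => ?_
    have e1 : Q.idxOf P[i] = i := by rw [← same, hP.2.2.1.idxOf_getElem]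
    have e2 : Q.idxOf P[i] < Q.length := by omega
    have := List.getElem_idxOf e2
    simp only [e1] at this
    exact this.symm
  rw [this] at hlt
  exact lt_irrefl _ hlt

/-- The transit times of a set of selected paths. -/
lemma sum_pathTransit_add_card_le {V : Type*} [Fintype V] [DecidableEq V] {N : EvacNetwork V}
    {rank : List V → ℕ} (hτ : 0 < N.maxTransit)
    (hrank : Function.Injective rank) (U : Finset (List V))
    (hU : ∀ Q ∈ U, N.IsPath Q ∧ 0 < N.greedyCap rank Q) :
    ∑ Q ∈ U, N.pathTransit Q + U.card ≤ U.card * ((Fintype.card V - 1) * N.maxTransit) + 1 := by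
  rcases U.eq_empty_or_nonempty with rfl | hne
  · simp
  obtain ⟨P, hP, hmax⟩ := Finset.exists_max_image U (N.pathKey rank) hne
  set D := (Fintype.card V - 1) * N.maxTransit with hD
  -- Every path except the last one saves a unit; the exception is the `+ 1` of the statement.
  have h1 : ∑ Q ∈ U.erase P, (N.pathTransit Q + 1) ≤ (U.erase P).card * D := by
    rw [← smul_eq_mul]
    refine Finset.sum_le_card_nsmul _ _ _ fun Q hQ => ?_
    rw [Finset.mem_erase] at hQ
    refine pathTransit_lt_of_before hτ hrank (hU Q hQ.2).1 (hU P hP).1 (hU Q hQ.2).2 (hU P hP).2 ?_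
    exact lt_of_le_of_ne (hmax Q hQ.2) fun h => hQ.1 (N.pathKey_injective hrank h)
  rw [Finset.sum_add_distrib, Finset.sum_const, smul_eq_mul, mul_one] at h1
  have h2 := (hU P hP).1.transit_le
  have h3 := Finset.add_sum_erase U N.pathTransit hP
  have h4 := Finset.card_erase_add_one hP
  rw [← h3, ← h4, add_mul, one_mul]
  omega

end Greedy

/-! ### Routes, waiting and direct routes. -/

section Routes

/-- Telescoping along the walk. The one-node walk is separate because waiting may make `dep u`
exceed `arr u`. -/
lemma route_step {N : EvacNetwork V} {arr dep : V → ℕ} (l : List V) (u v : V)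
    (hv : (u :: l).getLast? = some v) (h1 : ∀ w ∈ u :: l, arr w ≤ dep w)
    (h2 : ∀ e ∈ pathEdges (u :: l), arr e.2 = dep e.1 + N.transit e) :
    (l = [] ∧ v = u) ∨ dep u + N.pathTransit (u :: l) ≤ arr v := by
  induction l generalizing u with
  | nil => exact Or.inl ⟨rfl, by simpa [eq_comm] using hv⟩
  | cons w l ih =>
    rw [pathEdges_cons_cons] at h2
    have h3 : arr w = dep u + N.transit (u, w) := h2 (u, w) List.mem_cons_self
    have h4 : arr w ≤ dep w := h1 w (by simp)
    rw [List.getLast?_cons_cons] at hv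
    right
    rw [pathTransit_cons_cons]
    rcases ih w hv (fun x hx => h1 x (List.mem_cons_of_mem _ hx))
      (fun e he => h2 e (List.mem_cons_of_mem _ he)) with ⟨rfl, rfl⟩ | h
    · simp only [pathTransit, pathEdges, List.tail_cons, List.zip_nil_right, List.map_nil,
        List.sum_nil]
      omega
    · omega

variable [DecidableEq V]

/-- A route cannot be faster than its path. -/
lemma IsRoute.bounds {N : EvacNetwork V} {r : EvacRoute V} (h : N.IsRoute r) {v : V}
    (hv : v ∈ r.path) :
    r.dep N.source + N.pathTransit r.path ≤ r.arr v + N.suffixTransit r.path v ∧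
      r.dep v + N.suffixTransit r.path v ≤ r.arr N.sink := by
  obtain ⟨hP, h1, h2, h3, h4⟩ := h
  obtain ⟨A, B, hAB, -, hs, ht⟩ := N.exists_split hP.2.2.1 hv
  have hsrc := hP.1
  have hsnk := hP.2.1
  rw [hAB, pathEdges_append_cons] at h2
  rw [hAB] at h1 hsrc
  rw [hAB, List.getLast?_append_cons] at hsnk
  constructor
  · have key : r.dep N.source + N.pathTransit (A ++ [v]) ≤ r.arr v := by
      cases A with
      | nil =>
        obtain rfl : v = N.source := by simpa using hsrc
        simp [pathTransit, pathEdges, h3]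
      | cons u A =>
        obtain rfl : u = N.source := by simpa using hsrc
        rcases route_step (N := N) (arr := r.arr) (dep := r.dep) (A ++ [v]) N.source v
          (by rw [← List.cons_append, List.getLast?_concat])
          (fun w hw => h1 w (by simp at hw ⊢; tauto))
          (fun e he => h2 e (List.mem_append_left _ he)) with h | h
        · simp at h
        · exact h
    omega
  · rw [hs]
    rcases route_step (N := N) (arr := r.arr) (dep := r.dep) B v N.sink hsnk
      (fun w hw => h1 w (List.mem_append_right _ hw))
      (fun e he => h2 e (List.mem_append_right _ he)) with ⟨rfl, rfl⟩ | h
    · simp [pathTransit, pathEdges, h4]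
    · exact h

/-- A route without waiting on the way. -/
def IsDirect (N : EvacNetwork V) (r : EvacRoute V) : Prop :=
  N.IsRoute r ∧ ∀ v ∈ r.path, r.arr v = r.dep v ∧
    r.dep v + N.suffixTransit r.path v = r.arr N.sink

/-- Zero delay squeezes the two inequalities of `IsRoute.bounds` into equalities at every node;
truncation in `delay` does no harm. -/
lemma IsRoute.isDirect {N : EvacNetwork V} {r : EvacRoute V} (h : N.IsRoute r)
    (hd : N.delay r = 0) : N.IsDirect r := by
  refine ⟨h, fun v hv => ?_⟩
  obtain ⟨b1, b2⟩ := h.bounds hv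
  have b3 := h.2.1 v hv
  unfold delay at hd
  omega

/-- The direct route along `P` that arrives at time `a`. -/
def directRoute (N : EvacNetwork V) (P : List V) (a : ℕ) : EvacRoute V where
  path := P
  arr v := a - N.suffixTransit P v
  dep v := a - N.suffixTransit P v

lemma directRoute_arr_sink {N : EvacNetwork V} {P : List V} (hP : N.IsPath P) (a : ℕ) :
    (N.directRoute P a).arr N.sink = a := by
  simp [directRoute, N.suffixTransit_sink hP]

lemma isRoute_directRoute {N : EvacNetwork V} {P : List V} (hP : N.IsPath P) {a : ℕ}
    (ha : N.pathTransit P ≤ a) : N.IsRoute (N.directRoute P a) := by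
  refine ⟨hP, fun v _ => le_rfl, fun e he => ?_, rfl, rfl⟩
  have h1 := N.suffixTransit_edge hP.2.2.1 he
  have h2 := N.suffixTransit_le hP.2.2.1 (fst_mem_of_mem_pathEdges he)
  simp only [directRoute]
  omega

lemma delay_directRoute {N : EvacNetwork V} {P : List V} (hP : N.IsPath P) {a : ℕ}
    (ha : N.pathTransit P ≤ a) : N.delay (N.directRoute P a) = 0 := by
  rw [delay, directRoute_arr_sink hP]
  simp only [directRoute, N.suffixTransit_source hP]
  omega

/-- Without waiting, the arrival time at the sink fixes the single time at which an element is used,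
so slots alone describe the reservations. -/
lemma IsDirect.uses_iff {N : EvacNetwork V} {r : EvacRoute V} (h : N.IsDirect r)
    {x : Element V} {z : ℕ} :
    Uses r x z ↔ On x r.path ∧ r.arr N.sink = z + N.suffixTransit r.path (base x) := by
  have key : ∀ v ∈ r.path, r.arr N.sink = z + N.suffixTransit r.path v ↔ z = r.dep v := by
    intro v hv
    have := (h.2 v hv).2
    omega
  cases x with
  | inl v =>
    simp only [Uses, On, base, Sum.elim_inl, EvacRoute.UsesNode, id]
    refine and_congr_right fun hv => ?_
    rw [key v hv, (h.2 v hv).1]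
    omega
  | inr e =>
    simp only [Uses, On, base, Sum.elim_inr, EvacRoute.UsesEdge]
    refine and_congr_right fun he => ?_
    rw [key _ (fst_mem_of_mem_pathEdges he)]

omit [DecidableEq V] in
lemma IsRoute.uses_dep {N : EvacNetwork V} {r : EvacRoute V} (h : N.IsRoute r)
    {x : Element V} (hx : On x r.path) : Uses r x (r.dep (base x)) := by
  cases x with
  | inl v => exact ⟨hx, h.2.1 v hx, le_rfl⟩
  | inr e => exact ⟨hx, rfl⟩

open Classical in
/-- The capacity of the element `x` at time `z` that is reserved by `R`. -/
noncomputable def reserved (R : List (EvacRoute V × ℕ)) (x : Element V) (z : ℕ) : ℕ :=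
  (R.map fun g => if Uses g.1 x z then g.2 else 0).sum

omit [DecidableEq V] in
lemma mem_availAlong {N : EvacNetwork V} {R : List (EvacRoute V × ℕ)} {r : EvacRoute V} {c : ℕ} :
    c ∈ N.availAlong R r ↔ ∃ x z, Uses r x z ∧ c = N.cap x - reserved R x z := by
  constructor
  · rintro (⟨v, z, h, rfl⟩ | ⟨e, z, h, rfl⟩)
    · exact ⟨Sum.inl v, z, h, rfl⟩
    · exact ⟨Sum.inr e, z, h, rfl⟩
  · rintro ⟨v | e, z, h, rfl⟩
    · exact Or.inl ⟨v, z, h, rfl⟩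
    · exact Or.inr ⟨e, z, h, rfl⟩

end Routes

/-! ### CCRP fills the slots in lexicographic order. -/

section Slots

/-- An arrival time together with a path. -/
abbrev Slot (V : Type*) := ℕ × List V

/-- The order in which CCRP fills the slots. -/
def slotKey (N : EvacNetwork V) (rank : List V → ℕ) (κ : Slot V) : ℕ ×ₗ ℕ ×ₗ ℕ :=
  toLex (κ.1, N.pathKey rank κ.2)

lemma slotKey_injective (N : EvacNetwork V) {rank : List V → ℕ}
    (hrank : Function.Injective rank) : Function.Injective (N.slotKey rank) := by
  intro κ μ h
  have h' := Prod.ext_iff.1 (toLex.injective h)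
  exact Prod.ext h'.1 (N.pathKey_injective hrank h'.2)

lemma slotKey_le {N : EvacNetwork V} {rank : List V → ℕ} {κ μ : Slot V} (h1 : κ.1 ≤ μ.1)
    (h2 : N.pathKey rank κ.2 ≤ N.pathKey rank μ.2) : N.slotKey rank κ ≤ N.slotKey rank μ := by
  rw [slotKey, slotKey, Prod.Lex.toLex_le_toLex]
  rcases h1.lt_or_eq with h | h
  · exact Or.inl h
  · exact Or.inr ⟨h, h2⟩

lemma fst_le_of_slotKey_le {N : EvacNetwork V} {rank : List V → ℕ} {κ μ : Slot V}
    (h : N.slotKey rank κ ≤ N.slotKey rank μ) : κ.1 ≤ μ.1 := by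
  rw [slotKey, slotKey, Prod.Lex.toLex_le_toLex] at h
  rcases h with h | h
  · exact h.le
  · exact h.1.le

/-- The slot of a route. -/
def slot (N : EvacNetwork V) (r : EvacRoute V) : Slot V := (r.arr N.sink, r.path)

lemma routeKey_le {N : EvacNetwork V} {rank : List V → ℕ} {r r' : EvacRoute V}
    (h : N.routeKey rank r ≤ N.routeKey rank r') :
    N.slotKey rank (N.slot r) < N.slotKey rank (N.slot r') ∨
      N.slotKey rank (N.slot r) = N.slotKey rank (N.slot r') ∧ N.delay r ≤ N.delay r' := by
  simp only [routeKey, Prod.Lex.toLex_le_toLex] at h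
  simp only [slotKey, pathKey, slot, Prod.Lex.toLex_lt_toLex, toLex_inj, Prod.mk.injEq]
  tauto

variable [Finite V]

/-- The slots that are worth using. -/
def IsSlot (N : EvacNetwork V) (rank : List V → ℕ) (κ : Slot V) : Prop :=
  N.IsPath κ.2 ∧ 0 < N.greedyCap rank κ.2 ∧ N.pathTransit κ.2 ≤ κ.1

/-- The plan `R` fills exactly the slots in `K`. -/
structure Fills [DecidableEq V] (N : EvacNetwork V) (rank : List V → ℕ)
    (R : List (EvacRoute V × ℕ)) (K : Finset (Slot V)) : Prop where
  direct : ∀ g ∈ R, N.IsDirect g.1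
  slot_mem : ∀ g ∈ R, N.slot g.1 ∈ K
  isSlot : ∀ κ ∈ K, N.IsSlot rank κ
  lower : ∀ κ ∈ K, ∀ μ, N.IsSlot rank μ → N.slotKey rank μ ≤ N.slotKey rank κ → μ ∈ K
  -- A general weight `F` serves two purposes: constant `1` counts people, an indicator computes
  -- reserved capacity.
  sum_eq : ∀ F : Slot V → ℕ, (R.map fun g => F (N.slot g.1) * g.2).sum =
    ∑ κ ∈ K, F κ * N.greedyCap rank κ.2

variable {N : EvacNetwork V} {rank : List V → ℕ}

/-- The first path in which, after the paths up to `Q`, nothing is left on `P`. -/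
lemma exists_threshold (hrank : Function.Injective rank) {P : List V} (hP : N.IsPath P) :
    ∃ Q, N.pathKey rank Q ≤ N.pathKey rank P ∧ N.OpenPath rank (N.Before rank Q) P ∧
      ∃ x, On x P ∧ N.cap x ≤ N.used rank (N.Upto rank Q) x := by
  classical
  let s : Set (List V) := {Q | ∃ x, On x P ∧ N.cap x ≤ N.used rank (N.Upto rank Q) x}
  have hPs : P ∈ s := by
    obtain ⟨x, hx, h⟩ := exists_saturated hrank hP
    exact ⟨x, hx, h.ge⟩
  have wf := N.wellFounded_pathKey rank
  refine ⟨wf.min s ⟨P, hPs⟩, not_lt.1 (wf.not_lt_min s hPs), ⟨hP, fun x hx => ?_⟩,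
    wf.min_mem s ⟨P, hPs⟩⟩
  -- Otherwise the last path before `Q` through `x` would already meet the threshold, against the
  -- minimality of `Q`.
  by_contra! hge
  set Q := wf.min s ⟨P, hPs⟩
  have hpos := (cap_pos hP hx).trans_le hge
  obtain ⟨X, hX, hmax⟩ := Finset.exists_max_image
    (N.paths.filter fun X => N.Before rank Q X ∧ On x X) (N.pathKey rank) (by
      by_contra h0
      refine hpos.ne' (Finset.sum_eq_zero fun X hX => absurd ⟨X, ?_⟩ h0)
      simpa using hX)
  simp only [Finset.mem_filter, mem_paths] at hX hmax
  have hXs : X ∈ s := ⟨x, hx, hge.trans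
    (used_mono_of_pos fun Y h1 h2 _ h3 => hmax Y ⟨h1, h3, h2⟩)⟩
  exact wf.not_lt_min s hXs hX.2.1

variable [DecidableEq V]

/-- A direct group on `Q` uses `x` at time `z` exactly when it arrives at `z` plus the remaining
transit time. Thus each path contributes at most one slot, and a reservation in time becomes a
static quantity. -/
lemma Fills.reserved_eq {R : List (EvacRoute V × ℕ)} {K : Finset (Slot V)}
    (h : N.Fills rank R K) (x : Element V) (z : ℕ) :
    reserved R x z =
      N.used rank (fun Q => (z + N.suffixTransit Q (base x), Q) ∈ K) x := by
  classical
  have h1 : reserved R x z = (R.map fun g =>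
      (if On x (N.slot g.1).2 ∧ (N.slot g.1).1 =
        z + N.suffixTransit (N.slot g.1).2 (base x) then 1 else 0) * g.2).sum := by
    rw [reserved]
    congr 1
    refine List.map_congr_left fun g hg => ?_
    have hu := (h.direct g hg).uses_iff (x := x) (z := z)
    by_cases h0 : Uses g.1 x z
    · rw [if_pos h0, if_pos (by exact hu.1 h0), one_mul]
    · rw [if_neg h0, if_neg (by exact fun h1 => h0 (hu.2 h1)), zero_mul]
  rw [h1, h.sum_eq fun κ => if On x κ.2 ∧ κ.1 = z + N.suffixTransit κ.2 (base x) then 1 else 0]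
  simp only [ite_mul, one_mul, zero_mul]
  rw [← Finset.sum_filter, used]
  refine Finset.sum_nbij' Prod.snd (fun Q => (z + N.suffixTransit Q (base x), Q)) ?_ ?_ ?_ ?_ ?_
  · rintro ⟨b, Q⟩ hκ
    simp only [Finset.mem_filter, mem_paths] at hκ ⊢
    obtain ⟨h2, h3, rfl⟩ := hκ
    exact ⟨(h.isSlot _ h2).1, h2, h3⟩
  · intro Q hQ
    simp only [Finset.mem_filter] at hQ ⊢
    exact ⟨hQ.2.1, hQ.2.2, trivial⟩
  · rintro ⟨b, Q⟩ hκ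
    simp only [Finset.mem_filter] at hκ
    rw [hκ.2.2]
  · intros; rfl
  · intros; rfl

/-- The slots in `K` are those before `κ₀`. -/
def NextSlot (N : EvacNetwork V) (rank : List V → ℕ) (K : Finset (Slot V)) (κ₀ : Slot V) : Prop :=
  N.IsSlot rank κ₀ ∧ ∀ κ, N.IsSlot rank κ → (κ ∈ K ↔ N.slotKey rank κ < N.slotKey rank κ₀)

/-- The first path of all is selected and has arbitrarily late slots, so the finite `K` misses some;
the least missing slot works because `K` is an initial segment. -/
lemma Fills.exists_nextSlot {R : List (EvacRoute V × ℕ)} {K : Finset (Slot V)}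
    (h : N.Fills rank R K) (hne : ∃ P, N.IsPath P) :
    ∃ κ₀, N.NextSlot rank K κ₀ := by
  obtain ⟨P, hP, hmin⟩ := Finset.exists_min_image N.paths (N.pathKey rank)
    (by obtain ⟨P, hP⟩ := hne; exact ⟨P, mem_paths.2 hP⟩)
  rw [mem_paths] at hP
  have hc : 0 < N.greedyCap rank P := by
    rw [greedyCap_pos_iff hP]
    refine ⟨hP, fun x hx => ?_⟩
    have : N.used rank (N.Before rank P) x ≤ 0 := by
      refine (used_mono_of_pos (D' := fun _ => False) fun Q hQ _ _ hlt => ?_).trans ?_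
      · exact absurd hlt (not_lt.2 (hmin Q (mem_paths.2 hQ)))
      · simp [used]
    exact this.trans_lt (cap_pos hP hx)
  let s : Set (Slot V) := {κ | N.IsSlot rank κ ∧ κ ∉ K}
  have hs : s.Nonempty := by
    refine ⟨(N.pathTransit P + (K.sup Prod.fst + 1), P), ⟨hP, hc, Nat.le_add_right _ _⟩,
      fun hK => ?_⟩
    have := Finset.le_sup (f := Prod.fst) hK
    simp only at this
    omega
  have wf : WellFounded fun κ μ => N.slotKey rank κ < N.slotKey rank μ :=
    InvImage.wf (N.slotKey rank) wellFounded_lt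
  have hm := wf.min_mem s hs
  refine ⟨wf.min s hs, hm.1, fun κ hκ => ⟨fun hK => ?_, fun hlt => ?_⟩⟩
  · by_contra! hle
    exact hm.2 (h.lower κ hK _ hm.1 hle)
  · by_contra hK
    exact wf.not_lt_min s ⟨hκ, hK⟩ hlt

/-- No feasible route remains before the next slot. -/
lemma Fills.slotKey_le_of_isFeasible {R : List (EvacRoute V × ℕ)} {K : Finset (Slot V)}
    {κ₀ : Slot V} (h : N.Fills rank R K) (hrank : Function.Injective rank)
    (hκ : N.NextSlot rank K κ₀) {r : EvacRoute V} (hr : N.IsFeasible R r) :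
    N.slotKey rank κ₀ ≤ N.slotKey rank (N.slot r) := by
  by_contra! hlt
  obtain ⟨Q₀, hQ₀, hopen, x, hx, hsat⟩ := exists_threshold hrank hr.1.1
  have hb := hr.1.bounds (base_mem hx)
  have ha := hr.1.2.1 _ (base_mem hx)
  have hpos := hr.2 _ (mem_availAlong.2 ⟨x, _, hr.1.uses_dep hx, rfl⟩)
  rw [h.reserved_eq] at hpos
  -- By exchange, each selected path through `x` up to `Q₀` has a slot that uses `x` at this moment,
  -- is long enough to start at a nonnegative time, and arrives no later than `r`. That slot
  -- precedes `κ₀`, so it is filled and `x` is saturated.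
  have hle : N.used rank (N.Upto rank Q₀) x ≤
      N.used rank (fun Q => (r.dep (base x) + N.suffixTransit Q (base x), Q) ∈ K) x := by
    refine used_mono_of_pos fun Q hQ hxQ hc hQQ => ?_
    obtain ⟨s1, s2⟩ := OpenPath.suffix_le hrank ((greedyCap_pos_iff hQ).1 hc)
      (hopen.anti fun X _ _ hX => lt_of_lt_of_le hX hQQ) (base_mem hxQ) (base_mem hx)
    have hslot : N.IsSlot rank (r.dep (base x) + N.suffixTransit Q (base x), Q) :=
      ⟨hQ, hc, by simp only; omega⟩
    rw [hκ.2 _ hslot]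
    refine lt_of_le_of_lt (slotKey_le ?_ (hQQ.trans hQ₀)) hlt
    simp only [slot]
    omega
  omega

/-- The availability along a direct route in the next slot. -/
lemma Fills.availAlong_eq {R : List (EvacRoute V × ℕ)} {K : Finset (Slot V)}
    {κ₀ : Slot V} (h : N.Fills rank R K) (hrank : Function.Injective rank)
    (hκ : N.NextSlot rank K κ₀) {r : EvacRoute V} (hr : N.IsDirect r) (hs : N.slot r = κ₀) :
    N.availAlong R r =
      {n | ∃ x, On x κ₀.2 ∧ n = N.cap x - N.used rank (N.Before rank κ₀.2) x} := by
  subst hs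
  obtain ⟨⟨hP, hc, hT⟩, hK⟩ := hκ
  simp only [slot] at hP hc hT hK ⊢
  -- At the moment when the new group uses `x`, exactly the selected paths before `r.path` occupy
  -- it: by exchange their slots arrive no later, while those of the other selected paths arrive no
  -- earlier and lose the tie.
  have key : ∀ x z, On x r.path → r.arr N.sink = z + N.suffixTransit r.path (base x) →
      reserved R x z = N.used rank (N.Before rank r.path) x := by
    intro x z hx hz
    rw [h.reserved_eq]
    have hopen := (greedyCap_pos_iff hP).1 hc
    refine used_congr fun Q hQ hxQ hcQ => ⟨fun hmem => ?_, fun hlt => ?_⟩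
    · have hlt := (hK _ (h.isSlot _ hmem)).1 hmem
      by_contra hle
      rw [not_lt] at hle
      have hopenQ := (greedyCap_pos_iff hQ).1 hcQ
      obtain ⟨s1, -⟩ := hopen.suffix_le hrank
        (hopenQ.anti fun X _ _ hX => lt_of_lt_of_le hX hle) (base_mem hx) (base_mem hxQ)
      refine absurd hlt (not_lt.2 (slotKey_le ?_ hle))
      simp only
      omega
    · have hopenQ := (greedyCap_pos_iff hQ).1 hcQ
      obtain ⟨s1, s2⟩ := hopenQ.suffix_le hrank
        (hopen.anti fun X _ _ hX => lt_trans hX hlt) (base_mem hxQ) (base_mem hx)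
      have hslot : N.IsSlot rank (z + N.suffixTransit Q (base x), Q) :=
        ⟨hQ, hcQ, by simp only; omega⟩
      rw [hK _ hslot]
      refine lt_of_le_of_ne (slotKey_le (by simp only; omega) (le_of_lt hlt)) fun heq => ?_
      obtain rfl : Q = r.path := congrArg Prod.snd (N.slotKey_injective hrank heq)
      exact lt_irrefl _ hlt
  ext n
  simp only [mem_availAlong, hr.uses_iff, Set.mem_ofPred_eq]
  constructor
  · rintro ⟨x, z, ⟨hx, hz⟩, rfl⟩
    exact ⟨x, hx, by rw [key x z hx hz]⟩
  · rintro ⟨x, hx, rfl⟩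
    have := (hr.2 _ (base_mem hx)).2
    exact ⟨x, r.dep (base x), ⟨hx, this.symm⟩, by rw [key x _ hx this.symm]⟩

omit [DecidableEq V] in
lemma isLeast_greedyCap {P : List V} (hP : N.IsPath P) :
    IsLeast {n | ∃ x, On x P ∧ n = N.cap x - N.used rank (N.Before rank P) x}
      (N.greedyCap rank P) := by
  refine ⟨exists_greedyCap_eq hP, ?_⟩
  rintro n ⟨x, hx, rfl⟩
  exact greedyCap_le hx

/-- CCRP chooses a direct route in the next slot. -/
lemma Fills.choice {R : List (EvacRoute V × ℕ)} {K : Finset (Slot V)}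
    (h : N.Fills rank R K) (hrank : Function.Injective rank) {r : EvacRoute V}
    (hr : N.IsFeasible R r)
    (hmin : ∀ r', N.IsFeasible R r' → N.routeKey rank r ≤ N.routeKey rank r') :
    N.IsDirect r ∧ N.NextSlot rank K (N.slot r) ∧
      IsLeast (N.availAlong R r) (N.greedyCap rank r.path) := by
  obtain ⟨κ₀, hκ⟩ := h.exists_nextSlot ⟨_, hr.1.1⟩
  obtain ⟨a, P⟩ := κ₀
  obtain ⟨hP, hc, hT⟩ := hκ.1
  simp only at hP hc hT
  have hd : N.delay (N.directRoute P a) = 0 := delay_directRoute hP hT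
  have hroute := isRoute_directRoute hP hT
  have hdir := hroute.isDirect hd
  have hslot : N.slot (N.directRoute P a) = (a, P) := by
    rw [slot, directRoute_arr_sink hP]
    rfl
  have hfeas : N.IsFeasible R (N.directRoute P a) := by
    refine ⟨hroute, fun c hc' => ?_⟩
    rw [h.availAlong_eq hrank hκ hdir hslot] at hc'
    exact hc.trans_le ((isLeast_greedyCap hP).2 hc')
  have hle := h.slotKey_le_of_isFeasible hrank hκ hr
  -- The chosen route cannot precede the next slot, and the direct route there is feasible. So it
  -- has that slot, and the last tie-break excludes waiting.
  rcases routeKey_le (hmin _ hfeas) with hlt | ⟨heq, hdel⟩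
  · rw [hslot] at hlt
    exact absurd hle (not_le.2 hlt)
  · rw [hslot] at heq
    have hs : N.slot r = (a, P) := N.slotKey_injective hrank heq
    have hrd : N.IsDirect r := hr.1.isDirect (by omega)
    refine ⟨hrd, hs ▸ hκ, ?_⟩
    rw [h.availAlong_eq hrank hκ hrd hs]
    obtain rfl : r.path = P := congrArg Prod.snd hs
    exact isLeast_greedyCap hP

omit [DecidableEq V] in
lemma NextSlot.notMem {K : Finset (Slot V)} {κ₀ : Slot V} (h : N.NextSlot rank K κ₀) :
    κ₀ ∉ K := fun hK => lt_irrefl _ ((h.2 _ h.1).1 hK)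

lemma Fills.append {R : List (EvacRoute V × ℕ)} {K : Finset (Slot V)}
    (h : N.Fills rank R K) (hrank : Function.Injective rank) {r : EvacRoute V}
    (hr : N.IsDirect r) (hκ : N.NextSlot rank K (N.slot r)) :
    N.Fills rank (R ++ [(r, N.greedyCap rank r.path)]) (insert (N.slot r) K) where
  direct g hg := by
    rcases List.mem_append.1 hg with hg | hg
    · exact h.direct g hg
    · rw [List.mem_singleton.1 hg]
      exact hr
  slot_mem g hg := by
    rcases List.mem_append.1 hg with hg | hg
    · exact Finset.mem_insert_of_mem (h.slot_mem g hg)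
    · rw [List.mem_singleton.1 hg]
      exact Finset.mem_insert_self _ _
  isSlot κ hK := by
    rcases Finset.mem_insert.1 hK with rfl | hK
    · exact hκ.1
    · exact h.isSlot κ hK
  lower κ hK μ hμ hle := by
    rw [Finset.mem_insert]
    rcases Finset.mem_insert.1 hK with rfl | hK
    · rcases hle.lt_or_eq with hlt | heq
      · exact Or.inr ((hκ.2 μ hμ).2 hlt)
      · exact Or.inl (N.slotKey_injective hrank heq)
    · exact Or.inr (h.lower κ hK μ hμ hle)
  sum_eq F := by
    rw [List.map_append, List.sum_append, h.sum_eq, Finset.sum_insert hκ.notMem]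
    simp [slot, add_comm]

/-- A group is smaller than the greedy capacity only when it takes all remaining evacuees. While
some are left, every group so far fills its slot completely. -/
lemma CCRPReach.fills (hrank : Function.Injective rank) {p : ℕ} {R : List (EvacRoute V × ℕ)}
    (h : N.CCRPReach p rank R) (hlt : evacuated R < p) : ∃ K, N.Fills rank R K := by
  induction h with
  | init => exact ⟨∅, by simp, by simp, by simp, by simp, by simp⟩
  | step R r g hR hleft hfeas hmin hgroup ih =>
    obtain ⟨K, hK⟩ := ih hleft
    obtain ⟨hd, hκ, hl⟩ := hK.choice hrank hfeas hmin
    obtain rfl : g = N.greedyCap rank r.path := by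
      rcases hgroup.1 with rfl | hg
      · simp [evacuated] at hlt hleft
        omega
      · exact IsLeast.unique ⟨hg, fun c hc => hgroup.2 (Set.mem_insert_of_mem _ hc)⟩ hl
    exact ⟨_, hK.append hrank hd hκ⟩

/-- The shape of the plan returned by CCRP. -/
lemma IsCCRPOutput.exists_fills (hrank : Function.Injective rank) {p : ℕ} (hp : 0 < p)
    {R : List (EvacRoute V × ℕ)} (h : N.IsCCRPOutput p rank R) :
    ∃ R' K r g, R = R' ++ [(r, g)] ∧ N.Fills rank R' K ∧ N.NextSlot rank K (N.slot r) ∧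
      0 < g ∧ g ≤ N.greedyCap rank r.path ∧ p = ∑ κ ∈ K, N.greedyCap rank κ.2 + g := by
  obtain ⟨hR, hev⟩ := h
  cases hR with
  | init => simp [evacuated] at hev; omega
  | step R r g hR hleft hfeas hmin hgroup =>
    obtain ⟨K, hK⟩ := hR.fills hrank hleft
    obtain ⟨hd, hκ, hl⟩ := hK.choice hrank hfeas hmin
    refine ⟨R, K, r, g, rfl, hK, hκ, ?_, hgroup.2 (Set.mem_insert_of_mem _ hl.1), ?_⟩
    · rcases hgroup.1 with rfl | hg
      · omega
      · exact hfeas.2 _ hg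
    · have := hK.sum_eq fun _ => 1
      simp only [one_mul] at this
      rw [← hev, evacuated, List.map_append, List.sum_append, ← this]
      simp

end Slots

/-! ### SSEP selects an initial segment of the greedy paths. -/

section Selection

open Classical in
/-- The capacity of the element `x` taken by the paths in `S`. -/
noncomputable def taken (S : List (List V × ℕ)) (x : Element V) : ℕ :=
  (S.map fun a => if On x a.1 then a.2 else 0).sum

lemma residualAlong_eq (N : EvacNetwork V) (S : List (List V × ℕ)) (P : List V) :
    N.residualAlong S P = {n | ∃ x, On x P ∧ n = N.cap x - taken S x} := by
  have hv : ∀ v, N.residualNode S v = N.cap (Sum.inl v) - taken S (Sum.inl v) := by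
    intro v
    refine congrArg (N.nodeCap v - List.sum ·) (List.map_congr_left fun a _ => ?_)
    by_cases h : v ∈ a.1 <;> simp [On, h]
  have he : ∀ e, N.residualEdge S e = N.cap (Sum.inr e) - taken S (Sum.inr e) := by
    intro e
    refine congrArg (N.edgeCap e - List.sum ·) (List.map_congr_left fun a _ => ?_)
    by_cases h : e ∈ pathEdges a.1 <;> simp [On, h]
  ext c
  constructor
  · rintro (⟨v, h, rfl⟩ | ⟨e, h, rfl⟩)
    · exact ⟨Sum.inl v, h, hv v⟩
    · exact ⟨Sum.inr e, h, he e⟩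
  · rintro ⟨v | e, h, rfl⟩
    · exact Or.inl ⟨v, h, (hv v).symm⟩
    · exact Or.inr ⟨e, h, (he e).symm⟩

variable [Finite V]

/-- `S` consists of the first selected paths, with their capacities. -/
structure Selects (N : EvacNetwork V) (rank : List V → ℕ) (S : List (List V × ℕ)) : Prop where
  nodup : (S.map Prod.fst).Nodup
  isPath : ∀ a ∈ S, N.IsPath a.1
  pos : ∀ a ∈ S, 0 < N.greedyCap rank a.1
  cap_eq : ∀ a ∈ S, a.2 = N.greedyCap rank a.1
  lower : ∀ a ∈ S, ∀ Q, N.IsPath Q → 0 < N.greedyCap rank Q →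
    N.pathKey rank Q ≤ N.pathKey rank a.1 → Q ∈ S.map Prod.fst

/-- `P` is the next selected path after those in `S`. -/
structure NextPath (N : EvacNetwork V) (rank : List V → ℕ) (S : List (List V × ℕ))
    (P : List V) : Prop where
  isPath : N.IsPath P
  pos : 0 < N.greedyCap rank P
  notMem : P ∉ S.map Prod.fst
  le : ∀ Q, N.IsPath Q → 0 < N.greedyCap rank Q → Q ∉ S.map Prod.fst →
    N.pathKey rank P ≤ N.pathKey rank Q

variable {N : EvacNetwork V} {rank : List V → ℕ} {S : List (List V × ℕ)} {P : List V}

lemma Selects.taken_eq (h : N.Selects rank S) (x : Element V) :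
    taken S x = N.used rank (· ∈ S.map Prod.fst) x := by
  classical
  have h1 : taken S x =
      ((S.map Prod.fst).map fun Q => if On x Q then N.greedyCap rank Q else 0).sum := by
    rw [taken, List.map_map]
    congr 1
    refine List.map_congr_left fun a ha => ?_
    simp [h.cap_eq a ha]
  rw [h1, ← List.sum_toFinset _ h.nodup, ← Finset.sum_filter, used]
  refine Finset.sum_congr ?_ fun _ _ => rfl
  ext Q
  simp only [Finset.mem_filter, List.mem_toFinset, mem_paths]
  constructor
  · rintro ⟨hQ, hx⟩
    obtain ⟨a, ha, rfl⟩ := List.mem_map.1 hQ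
    exact ⟨h.isPath a ha, hQ, hx⟩
  · rintro ⟨-, hQ, hx⟩
    exact ⟨hQ, hx⟩

lemma Selects.isResidualPath_iff (h : N.Selects rank S) :
    N.IsResidualPath S P ↔ N.OpenPath rank (· ∈ S.map Prod.fst) P := by
  rw [IsResidualPath, residualAlong_eq, OpenPath]
  refine and_congr_right fun _ => ⟨fun h1 x hx => ?_, ?_⟩
  · have := h1 _ ⟨x, hx, rfl⟩
    rw [h.taken_eq] at this
    omega
  · rintro h1 c ⟨x, hx, rfl⟩
    have := h1 x hx
    rw [h.taken_eq]
    omega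

lemma exists_nextPath_of_notMem (h : ∃ Q, N.IsPath Q ∧ 0 < N.greedyCap rank Q ∧
    Q ∉ S.map Prod.fst) : ∃ P, N.NextPath rank S P := by
  let s : Set (List V) := {Q | N.IsPath Q ∧ 0 < N.greedyCap rank Q ∧ Q ∉ S.map Prod.fst}
  have wf := N.wellFounded_pathKey rank
  obtain ⟨h1, h2, h3⟩ := wf.min_mem s h
  exact ⟨wf.min s h, h1, h2, h3, fun Q q1 q2 q3 => not_lt.1 (wf.not_lt_min s ⟨q1, q2, q3⟩)⟩

/-- If all selected paths were in `S`, the greedy procedure would have saturated an element of the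
residual path. -/
lemma Selects.exists_nextPath (h : N.Selects rank S) (hrank : Function.Injective rank)
    (hP : N.IsResidualPath S P) : ∃ P, N.NextPath rank S P := by
  refine exists_nextPath_of_notMem ?_
  by_contra! hall
  rw [h.isResidualPath_iff] at hP
  obtain ⟨x, hx, hs⟩ := exists_saturated hrank hP.1
  have h1 := hP.2 x hx
  have h2 : N.used rank (N.Upto rank P) x ≤ N.used rank (· ∈ S.map Prod.fst) x :=
    used_mono_of_pos fun Q q1 _ q3 _ => hall Q q1 q3
  omega

lemma Selects.mem_iff (h : N.Selects rank S) (hP : N.NextPath rank S P) {Q : List V}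
    (hQ : N.IsPath Q) (hc : 0 < N.greedyCap rank Q) :
    Q ∈ S.map Prod.fst ↔ N.pathKey rank Q < N.pathKey rank P := by
  constructor
  · intro hmem
    by_contra! hle
    obtain ⟨a, ha, rfl⟩ := List.mem_map.1 hmem
    exact hP.notMem (h.lower a ha P hP.isPath hP.pos hle)
  · intro hlt
    by_contra hmem
    exact absurd hlt (not_lt.2 (hP.le Q hQ hc hmem))

lemma Selects.used_eq (h : N.Selects rank S) (hP : N.NextPath rank S P) (x : Element V) :
    N.used rank (· ∈ S.map Prod.fst) x = N.used rank (N.Before rank P) x :=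
  used_congr fun _ hQ _ hc => h.mem_iff hP hQ hc

lemma Selects.isResidualPath_iff_openPath (h : N.Selects rank S) (hP : N.NextPath rank S P)
    {Q : List V} : N.IsResidualPath S Q ↔ N.OpenPath rank (N.Before rank P) Q := by
  rw [h.isResidualPath_iff, OpenPath, OpenPath]
  simp only [h.used_eq hP]

lemma Selects.isLeast (h : N.Selects rank S) (hP : N.NextPath rank S P) :
    IsLeast (N.residualAlong S P) (N.greedyCap rank P) := by
  rw [residualAlong_eq]
  simp only [h.taken_eq, h.used_eq hP]
  exact isLeast_greedyCap hP.isPath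

/-- SSEP can continue with the next path. -/
lemma Selects.ssepStep (h : N.Selects rank S) (hrank : Function.Injective rank)
    (hP : N.NextPath rank S P) {p : ℕ} (hlen : S.length < p)
    (hT : S ≠ [] → (N.pathTransit P : ℤ) ≤ N.CET p S) :
    N.SSEPStep p rank S P (N.greedyCap rank P) where
  length_lt := hlen
  residual := (h.isResidualPath_iff_openPath hP).2 ((greedyCap_pos_iff hP.isPath).1 hP.pos)
  shortest _ hP' := ((h.isResidualPath_iff_openPath hP).1 hP').le hrank
  capacity := h.isLeast hP
  transit_le := hT

/-- SSEP can only continue with the next path. -/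
lemma Selects.choice (h : N.Selects rank S) (hrank : Function.Injective rank) {p C : ℕ}
    (hs : N.SSEPStep p rank S P C) : N.NextPath rank S P ∧ C = N.greedyCap rank P := by
  obtain ⟨P₀, hP₀⟩ := h.exists_nextPath hrank hs.residual
  have h1 := ((h.isResidualPath_iff_openPath hP₀).1 hs.residual).le hrank
  have h2 := hs.shortest P₀
    ((h.isResidualPath_iff_openPath hP₀).2 ((greedyCap_pos_iff hP₀.isPath).1 hP₀.pos))
  obtain rfl : P = P₀ := N.pathKey_injective hrank (le_antisymm h2 h1)
  exact ⟨hP₀, hs.capacity.unique (h.isLeast hP₀)⟩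

lemma Selects.append (h : N.Selects rank S) (hrank : Function.Injective rank)
    (hP : N.NextPath rank S P) : N.Selects rank (S ++ [(P, N.greedyCap rank P)]) where
  nodup := by
    rw [List.map_append, List.map_singleton]
    exact List.nodup_append.2 ⟨h.nodup, List.nodup_singleton _, fun a ha b hb hab =>
      hP.notMem (by rw [List.mem_singleton.1 hb] at hab; subst hab; exact ha)⟩
  isPath a ha := by
    rcases List.mem_append.1 ha with ha | ha
    · exact h.isPath a ha
    · rw [List.mem_singleton.1 ha]
      exact hP.isPath
  pos a ha := by
    rcases List.mem_append.1 ha with ha | ha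
    · exact h.pos a ha
    · rw [List.mem_singleton.1 ha]
      exact hP.pos
  cap_eq a ha := by
    rcases List.mem_append.1 ha with ha | ha
    · exact h.cap_eq a ha
    · rw [List.mem_singleton.1 ha]
  lower a ha Q hQ hc hle := by
    rw [List.map_append, List.mem_append]
    rcases List.mem_append.1 ha with ha | ha
    · exact Or.inl (h.lower a ha Q hQ hc hle)
    · rw [List.mem_singleton.1 ha] at hle
      rcases hle.lt_or_eq with hlt | heq
      · exact Or.inl ((h.mem_iff hP hQ hc).2 hlt)
      · right
        rw [N.pathKey_injective hrank heq]
        simp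

lemma SSEPReach.selects (hrank : Function.Injective rank) {p : ℕ}
    (h : N.SSEPReach p rank S) : N.Selects rank S := by
  induction h with
  | init => exact ⟨by simp, by simp, by simp, by simp, by simp⟩
  | step S P C hS hstep ih =>
    obtain ⟨hP, rfl⟩ := ih.choice hrank hstep
    exact ih.append hrank hP

omit [Finite V] in
-- `⌈x⌉ - 1` is the largest integer strictly below `x`; hence the strict inequality.
lemma le_CET_iff {p : ℕ} (hC : 0 < (S.map Prod.snd).sum) (m : ℤ) :
    m ≤ N.CET p S ↔
      m * ((S.map Prod.snd).sum : ℕ) <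
        ((p + (S.map fun a => a.2 * N.pathTransit a.1).sum : ℕ) : ℤ) := by
  rw [CET]
  generalize (S.map Prod.snd).sum = C at hC ⊢
  rw [le_sub_iff_add_le, Int.add_one_le_iff, Int.lt_ceil, lt_div_iff₀ (by exact_mod_cast hC)]
  rw [← Int.cast_natCast C, ← Int.cast_natCast (p + _), ← Int.cast_mul, Int.cast_lt]

/-- By `le_CET_iff` the test for `P` survives adding `P`: both sides grow by its capacity times its
transit time. Earlier paths are no longer than `P`. -/
lemma SSEPReach.transit_le_CET (hrank : Function.Injective rank) {p : ℕ} (hp : 0 < p)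
    (h : N.SSEPReach p rank S) : ∀ a ∈ S, (N.pathTransit a.1 : ℤ) ≤ N.CET p S := by
  induction h with
  | init => simp
  | step S P C hS hstep ih =>
    have hsel := hS.selects hrank
    obtain ⟨hP, rfl⟩ := hsel.choice hrank hstep
    have hc := hP.pos
    have hlast : (N.pathTransit P : ℤ) ≤ N.CET p (S ++ [(P, N.greedyCap rank P)]) := by
      rw [le_CET_iff (by simp; omega)]
      simp only [List.map_append, List.sum_append, List.map_singleton, List.sum_singleton]
      -- The first path undergoes no test; for it `0 < p` suffices.
      by_cases h0 : S = []
      · subst h0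
        simp only [List.map_nil, List.sum_nil, zero_add]
        push_cast
        nlinarith
      · have h1 := hstep.transit_le h0
        have hpos : 0 < (S.map Prod.snd).sum := by
          cases S with
          | nil => exact absurd rfl h0
          | cons a S =>
            have h2 := hsel.pos a List.mem_cons_self
            have h3 := hsel.cap_eq a List.mem_cons_self
            simp only [List.map_cons, List.sum_cons]
            omega
        rw [le_CET_iff hpos] at h1
        push_cast at h1 ⊢
        nlinarith
    intro a ha
    rcases List.mem_append.1 ha with ha | ha
    · refine le_trans ?_ hlast
      have := (hsel.mem_iff hP (hsel.isPath a ha) (hsel.pos a ha)).1 (List.mem_map_of_mem ha)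
      exact_mod_cast pathTransit_mono this.le
    · rw [List.mem_singleton.1 ha]
      exact hlast

/-- The evacuation time of SSEP in terms of the number of people on the way. -/
lemma SSEPReach.exists_CET_eq [DecidableEq V] (hrank : Function.Injective rank) {p : ℕ}
    (hp : 0 < p) (h : N.SSEPReach p rank S) (hne : S ≠ []) :
    ∃ e : ℕ, N.CET p S = e ∧ (∀ Q ∈ (S.map Prod.fst).toFinset, N.pathTransit Q ≤ e) ∧
      ∑ Q ∈ (S.map Prod.fst).toFinset, N.greedyCap rank Q * (e - N.pathTransit Q) < p := by
  have hsel := h.selects hrank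
  have hT := h.transit_le_CET hrank hp
  obtain ⟨a, ha⟩ := List.exists_mem_of_ne_nil S hne
  obtain ⟨e, he⟩ := Int.eq_ofNat_of_zero_le ((Int.natCast_nonneg _).trans (hT a ha))
  have hTe : ∀ Q ∈ (S.map Prod.fst).toFinset, N.pathTransit Q ≤ e := by
    intro Q hQ
    obtain ⟨b, hb, rfl⟩ := List.mem_map.1 (List.mem_toFinset.1 hQ)
    have := hT b hb
    rw [he] at this
    exact_mod_cast this
  refine ⟨e, he, hTe, ?_⟩
  have sums : ∀ F : List V → ℕ, (S.map fun a => a.2 * F a.1).sum =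
      ∑ Q ∈ (S.map Prod.fst).toFinset, N.greedyCap rank Q * F Q := by
    intro F
    rw [List.sum_toFinset _ hsel.nodup, List.map_map]
    congr 1
    refine List.map_congr_left fun a ha => ?_
    simp [hsel.cap_eq a ha]
  have hcap : (S.map Prod.snd).sum =
      ∑ Q ∈ (S.map Prod.fst).toFinset, N.greedyCap rank Q := by
    simpa using sums fun _ => 1
  have hpos : 0 < (S.map Prod.snd).sum := by
    rw [hcap]
    refine Finset.sum_pos (fun Q hQ => ?_) ⟨a.1, List.mem_toFinset.2 (List.mem_map_of_mem ha)⟩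
    obtain ⟨b, hb, rfl⟩ := List.mem_map.1 (List.mem_toFinset.1 hQ)
    exact hsel.pos b hb
  -- The case `m = e`: subtracting the capacity-weighted transit times leaves the strict inequality
  -- of the statement.
  have h1 := (le_CET_iff (N := N) (p := p) hpos e).1 he.ge
  rw [sums N.pathTransit, hcap] at h1
  norm_cast at h1
  have h2 : ∑ Q ∈ (S.map Prod.fst).toFinset, N.greedyCap rank Q * (e - N.pathTransit Q) +
      ∑ Q ∈ (S.map Prod.fst).toFinset, N.greedyCap rank Q * N.pathTransit Q =
      e * ∑ Q ∈ (S.map Prod.fst).toFinset, N.greedyCap rank Q := by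
    rw [← Finset.sum_add_distrib, mul_comm e, Finset.sum_mul]
    refine Finset.sum_congr rfl fun Q hQ => ?_
    rw [← mul_add, Nat.sub_add_cancel (hTe Q hQ)]
  omega

end Selection

/-! ### Counting arrivals and comparing the two procedures. -/

section Bounds

variable [Fintype V] [DecidableEq V] {N : EvacNetwork V} {rank : List V → ℕ}

/-- If each path in `U` sends one person at a time then at most `p` people arrive before the time
`m`. -/
lemma le_evacBound (hτ : 0 < N.maxTransit) (hrank : Function.Injective rank) {p m : ℕ}
    {U : Finset (List V)} (hne : U.Nonempty)
    (hU : ∀ Q ∈ U, N.IsPath Q ∧ 0 < N.greedyCap rank Q) (hT : ∀ Q ∈ U, N.pathTransit Q ≤ m)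
    (hp : ∑ Q ∈ U, (m - N.pathTransit Q) < p) : (m : ℤ) ≤ N.evacBound p U.card := by
  have h1 := sum_pathTransit_add_card_le hτ hrank U hU
  have h2 : ∑ Q ∈ U, (m - N.pathTransit Q) + ∑ Q ∈ U, N.pathTransit Q = U.card * m := by
    rw [← Finset.sum_add_distrib, ← smul_eq_mul, ← Finset.sum_const]
    exact Finset.sum_congr rfl fun Q hQ => Nat.sub_add_cancel (hT Q hQ)
  have hk : 0 < U.card := hne.card_pos
  have hn : 0 < Fintype.card V := Fintype.card_pos_iff.2 ⟨N.source⟩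
  have h3 : U.card * m + U.card ≤ p + U.card * ((Fintype.card V - 1) * N.maxTransit) := by omega
  have h4 : (m : ℤ) - ((Fintype.card V : ℤ) - 1) * N.maxTransit + 1 ≤ ⌊(p : ℚ) / U.card⌋ := by
    rw [Int.le_floor, le_div_iff₀ (by exact_mod_cast hk)]
    zify [Nat.one_le_iff_ne_zero.2 hn.ne'] at h3
    have : ((m : ℤ) - ((Fintype.card V : ℤ) - 1) * N.maxTransit + 1) * U.card ≤ p := by
      linarith
    exact_mod_cast this
  unfold evacBound
  linarith

/-- The evacuation time of CCRP in terms of the numbers of people that have arrived. -/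
lemma IsCCRPOutput.exists_time (hτ : 0 < N.maxTransit) (hrank : Function.Injective rank) {p : ℕ}
    (hp : 0 < p) {R : List (EvacRoute V × ℕ)} (h : N.IsCCRPOutput p rank R) :
    ∃ a : ℕ, N.evacTime R ≤ a ∧ (a : ℤ) ≤ N.evacBound p (numPaths R) ∧
      p ≤ ∑ Q ∈ N.paths with N.pathTransit Q ≤ a,
        N.greedyCap rank Q * (a + 1 - N.pathTransit Q) := by
  obtain ⟨R', K, r, g, rfl, hK, hκ, hg, hgc, hpe⟩ := h.exists_fills hrank hp
  have hall : ∀ κ ∈ insert (N.slot r) K, N.IsSlot rank κ ∧ κ.1 ≤ r.arr N.sink := by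
    intro κ hmem
    rcases Finset.mem_insert.1 hmem with rfl | hmem
    · exact ⟨hκ.1, le_rfl⟩
    · have hs := hK.isSlot κ hmem
      exact ⟨hs, fst_le_of_slotKey_le ((hκ.2 κ hs).1 hmem).le⟩
  have hslot : ∀ g' ∈ R' ++ [(r, g)], N.slot g'.1 ∈ insert (N.slot r) K := by
    intro g' hg'
    rcases List.mem_append.1 hg' with hg' | hg'
    · exact Finset.mem_insert_of_mem (hK.slot_mem g' hg')
    · rw [List.mem_singleton.1 hg']
      exact Finset.mem_insert_self _ _
  refine ⟨r.arr N.sink, ?_, ?_, ?_⟩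
  · refine List.max_le_of_forall_le _ _ fun t ht => ?_
    obtain ⟨g', hg', rfl⟩ := List.mem_map.1 ht
    exact (hall _ (hslot g' hg')).2
  · have hU : ∀ Q ∈ ((R' ++ [(r, g)]).map fun g => g.1.path).toFinset,
        N.IsPath Q ∧ 0 < N.greedyCap rank Q ∧ N.pathTransit Q ≤ r.arr N.sink := by
      intro Q hQ
      obtain ⟨g', hg', rfl⟩ := List.mem_map.1 (List.mem_toFinset.1 hQ)
      obtain ⟨⟨h1, h2, h3⟩, h4⟩ := hall _ (hslot g' hg')
      exact ⟨h1, h2, h3.trans h4⟩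
    refine le_evacBound hτ hrank ⟨r.path, by simp⟩ (fun Q hQ => ⟨(hU Q hQ).1, (hU Q hQ).2.1⟩)
      (fun Q hQ => (hU Q hQ).2.2) ?_
    -- All slots of used paths with arrival time before the last one are filled, hence in `K`. Each
    -- holds at least one person, and the last group is nonempty, so the sum stays below `p`.
    have h1 : ∑ Q ∈ ((R' ++ [(r, g)]).map fun g => g.1.path).toFinset,
        (r.arr N.sink - N.pathTransit Q) ≤ K.card := by
      simp only [← Nat.card_Ico]
      rw [← Finset.card_sigma]
      refine Finset.card_le_card_of_injOn (fun y => (y.2, y.1)) ?_ ?_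
      · rintro ⟨Q, b⟩ hy
        simp only [Finset.coe_sigma, Set.mem_sigma_iff, Finset.mem_coe, Finset.mem_Ico] at hy
        obtain ⟨hQ, hb1, hb2⟩ := hy
        have hs : N.IsSlot rank (b, Q) := ⟨(hU Q hQ).1, (hU Q hQ).2.1, hb1⟩
        rw [Finset.mem_coe, hκ.2 _ hs, slotKey, slotKey, Prod.Lex.toLex_lt_toLex]
        exact Or.inl hb2
      · rintro ⟨Q, b⟩ - ⟨Q', b'⟩ - heq
        simp only [Prod.mk.injEq] at heq
        obtain ⟨rfl, rfl⟩ := heq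
        rfl
    have h2 : K.card ≤ ∑ κ ∈ K, N.greedyCap rank κ.2 := by
      rw [Finset.card_eq_sum_ones]
      exact Finset.sum_le_sum fun κ hmem => (hK.isSlot κ hmem).2.1
    omega
  · have h1 : p ≤ ∑ κ ∈ insert (N.slot r) K, N.greedyCap rank κ.2 := by
      rw [Finset.sum_insert hκ.notMem]
      simp only [slot]
      omega
    refine h1.trans ?_
    rw [← Finset.sum_fiberwise_of_maps_to (g := Prod.snd)
      (t := N.paths.filter fun Q => N.pathTransit Q ≤ r.arr N.sink) fun κ hmem => by
        obtain ⟨⟨c1, -, c3⟩, c4⟩ := hall κ hmem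
        simpa using ⟨c1, c3.trans c4⟩]
    -- A path `Q` has at most one slot for each arrival time from its transit time to that of the
    -- last group.
    refine Finset.sum_le_sum fun Q _ => ?_
    rw [Finset.sum_congr rfl (g := fun _ => N.greedyCap rank Q) fun κ hmem => by
      rw [(Finset.mem_filter.1 hmem).2], Finset.sum_const, smul_eq_mul, mul_comm,
      ← Nat.card_Icc]
    refine Nat.mul_le_mul_left _ (Finset.card_le_card_of_injOn Prod.fst ?_ ?_)
    · intro κ hmem
      obtain ⟨c1, rfl⟩ := Finset.mem_filter.1 (Finset.mem_coe.1 hmem)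
      obtain ⟨⟨-, -, c3⟩, c4⟩ := hall κ c1
      exact Finset.mem_coe.2 (Finset.mem_Icc.2 ⟨c3, c4⟩)
    · intro κ hmem μ hmem' heq
      exact Prod.ext heq ((Finset.mem_filter.1 (Finset.mem_coe.1 hmem)).2.trans
        (Finset.mem_filter.1 (Finset.mem_coe.1 hmem')).2.symm)

omit [DecidableEq V] in
lemma IsSSEPOutput.ne_nil (hrank : Function.Injective rank) {p : ℕ} (hp : 0 < p)
    {S : List (List V × ℕ)} (h : N.IsSSEPOutput p rank S) (hP : ∃ P, N.IsPath P) : S ≠ [] := by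
  rintro rfl
  have hsel := h.1.selects hrank
  obtain ⟨P, hP⟩ := hP
  obtain ⟨Q, hQ⟩ := hsel.exists_nextPath hrank (P := P) (by
    rw [hsel.isResidualPath_iff]
    exact ⟨hP, fun x hx => by simpa [used] using cap_pos hP hx⟩)
  exact h.2 _ _ (hsel.ssepStep hrank hQ hp fun h0 => absurd rfl h0)

/-- SSEP is not slower than a greedy schedule. -/
lemma IsSSEPOutput.CET_le (hrank : Function.Injective rank) {p : ℕ} (hp : 0 < p)
    {S : List (List V × ℕ)} (h : N.IsSSEPOutput p rank S) (hne : S ≠ []) {a : ℕ}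
    (ha : p ≤ ∑ Q ∈ N.paths with N.pathTransit Q ≤ a,
      N.greedyCap rank Q * (a + 1 - N.pathTransit Q)) : N.CET p S ≤ a := by
  have hsel := h.1.selects hrank
  obtain ⟨e, he, hTe, hlt⟩ := h.1.exists_CET_eq hrank hp hne
  rw [he]
  by_contra! hae
  have hae' : a < e := by exact_mod_cast hae
  -- If SSEP has all selected paths of transit time at most `a`, then by time `e - 1 ≥ a` they
  -- deliver at least `p` people, a contradiction.
  by_cases hall : ∀ Q, N.IsPath Q → 0 < N.greedyCap rank Q → N.pathTransit Q ≤ a →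
      Q ∈ S.map Prod.fst
  · refine absurd (ha.trans (le_trans (Finset.sum_le_sum fun Q _ => Nat.mul_le_mul_left _
      (Nat.sub_le_sub_right (Nat.succ_le_of_lt hae') _))
      (Finset.sum_le_sum_of_ne_zero fun Q hQ h0 => ?_))) (not_le.2 hlt)
    rw [Finset.mem_filter, mem_paths] at hQ
    exact List.mem_toFinset.2
      (hall Q hQ.1 (Nat.pos_of_ne_zero (left_ne_zero_of_mul h0)) hQ.2)
  · push Not at hall
    obtain ⟨Q, q1, q2, q3, q4⟩ := hall
    obtain ⟨P, hP⟩ := exists_nextPath_of_notMem ⟨Q, q1, q2, q4⟩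
    have hPa : N.pathTransit P ≤ a := (pathTransit_mono (hP.le Q q1 q2 q4)).trans q3
    -- The next path would pass the test, so only the limit on the number of paths stopped SSEP. But
    -- `p` paths, each delivering someone before `e`, already deliver `p` people.
    have hlen : p ≤ S.length := by
      by_contra! hlen
      refine h.2 _ _ (hsel.ssepStep hrank hP hlen fun _ => ?_)
      rw [he]
      exact_mod_cast hPa.trans hae'.le
    have hcard : (S.map Prod.fst).toFinset.card = S.length := by
      rw [List.toFinset_card_of_nodup hsel.nodup, List.length_map]
    have : (S.map Prod.fst).toFinset.card ≤
        ∑ Q ∈ (S.map Prod.fst).toFinset, N.greedyCap rank Q * (e - N.pathTransit Q) := by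
      rw [Finset.card_eq_sum_ones]
      refine Finset.sum_le_sum fun X hX => ?_
      have hX' := List.mem_toFinset.1 hX
      obtain ⟨b, hb, rfl⟩ := List.mem_map.1 hX'
      have h1 := hsel.pos b hb
      have h2 := pathTransit_mono ((hsel.mem_iff hP (hsel.isPath b hb) h1).1 hX').le
      exact Nat.mul_pos h1 (by omega)
    omega

end Bounds

end EvacNetwork

/-- Upper bound on the evacuation time of CCRP, and of SSEP, in a single-source single-sink
network; `rank` is the fixed ranking of paths by which both break ties. -/
theorem mainTheorem3 {V : Type*} [Fintype V] [DecidableEq V] (N : EvacNetwork V)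
    (hτ : 0 < N.maxTransit) (p : ℕ) (hp : 0 < p)
    (rank : List V → ℕ) (hrank : Function.Injective rank)
    (R : List (EvacRoute V × ℕ)) (hR : N.IsCCRPOutput p rank R)
    (S : List (List V × ℕ)) (hS : N.IsSSEPOutput p rank S) :
    (N.evacTime R : ℤ) ≤ N.evacBound p (EvacNetwork.numPaths R) ∧
    N.CET p S ≤ N.evacBound p (EvacNetwork.numPaths R) ∧
    N.CET p S ≤ N.evacBound p S.length := by
  obtain ⟨a, h1, h2, h3⟩ := hR.exists_time hτ hrank hp
  have hpath : ∃ P, N.IsPath P := by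
    obtain ⟨R', K, r, g, -, -, hκ, -⟩ := hR.exists_fills hrank hp
    exact ⟨_, hκ.1.1⟩
  have hne := hS.ne_nil hrank hp hpath
  refine ⟨(Int.ofNat_le.2 h1).trans h2, (hS.CET_le hrank hp hne h3).trans h2, ?_⟩
  have hsel := hS.1.selects hrank
  obtain ⟨e, he, hTe, hlt⟩ := hS.1.exists_CET_eq hrank hp hne
  have hpos : ∀ Q ∈ (S.map Prod.fst).toFinset, N.IsPath Q ∧ 0 < N.greedyCap rank Q := by
    intro Q hQ
    obtain ⟨b, hb, rfl⟩ := List.mem_map.1 (List.mem_toFinset.1 hQ)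
    exact ⟨hsel.isPath b hb, hsel.pos b hb⟩
  have hcard : (S.map Prod.fst).toFinset.card = S.length := by
    rw [List.toFinset_card_of_nodup hsel.nodup, List.length_map]
  rw [he, ← hcard]
  refine EvacNetwork.le_evacBound hτ hrank ?_ hpos hTe (lt_of_le_of_lt ?_ hlt)
  · rw [← Finset.card_pos, hcard]
    exact List.length_pos_of_ne_nil hne
  · exact Finset.sum_le_sum fun Q hQ => Nat.le_mul_of_pos_left _ (hpos Q hQ).2
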